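/- Let $k\ge 1$ and $n$ be natural numbers and let $\mathbb{B}^n=\{x\in\mathbb{R}^n:|x|\le 1\}$. Let $\Sigma$ be a compact smooth $k$-dimensional manifold with (possibly empty) boundary $\partial\Sigma$, and let $\varphi:\Sigma\to\mathbb{B}^n$ be a smooth immersion with $\varphi(\partial\Sigma)\subset\partial\mathbb{B}^n$. Suppose that $\varphi$ is a free boundary minimal immersion, that is: (i) the mean curvature vector $\vec H=\operatorname{Tr}A$ of $\varphi$ vanishes identically, where $A(u,v)=(D_uv)^N$ is the second fundamental form and the trace is taken with respect to the metric induced by $\varphi$; (ii) $\Sigma$ meets $\partial\mathbb{B}^n$ orthogonally along $\partial\Sigma$: at every $p\in\partial\Sigma$ the outward unit conormal $\nu$ of $\partial\Sigma$ in $\Sigma$ is orthogonal to $T_{\varphi(p)}\partial\mathbb{B}^n$. Let $|\Sigma|$ denote the total $k$-dimensional volume of $\Sigma$ and $|\partial\Sigma|$ the total $(k-1)$-dimensional volume of $\partial\Sigma$, with respect to the measures induced by $\varphi$ (for $k=1$, $|\partial\Sigma|$ is the number of points of $\partial\Sigma$). Then $|\Sigma|<\infty$ and $$k\,|\Sigma|=|\partial\Sigma|.$$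 -/

import Mathlib

open Set MeasureTheory
open scoped Manifold ContDiff ENNReal

noncomputable section

namespace FreeBoundary

/-- Euclidean space `ℝⁿ`. -/
abbrev Euc (n : ℕ) : Type := EuclideanSpace ℝ (Fin n)

section

variable (k : ℕ) [NeZero k] {n : ℕ} {M : Type*} [TopologicalSpace M]
  [ChartedSpace (EuclideanHalfSpace k) M]

/-- The differential `dφ_p : T_pM → ℝⁿ`. The tangent space `T_pM` is identified with `ℝᵏ` by
the preferred chart at `p`, which takes values in the half-space `{y | 0 ≤ y 0}`. In particular,
if `p ∈ ∂M`, then `T_p∂M = {v | v 0 = 0}`, and `v` points out of `M` iff `v 0 < 0`. -/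
def differential (φ : M → Euc n) (p : M) : Euc k →L[ℝ] Euc n :=
  mfderiv (𝓡∂ k) 𝓘(ℝ, Euc n) φ p

/-- The tangent space of the immersed submanifold at `p`, as a subspace of `ℝⁿ`. -/
def tangentPlane (φ : M → Euc n) (p : M) : Submodule ℝ (Euc n) :=
  LinearMap.range (differential k φ p : Euc k →ₗ[ℝ] Euc n)

/-- The normal component `w ↦ w^N` at `p` of a vector of `ℝⁿ`. -/
def normalPart (φ : M → Euc n) (p : M) : Euc n →L[ℝ] Euc n :=
  (tangentPlane k φ p)ᗮ.starProjection

/-- `φ` written in the preferred chart at `p`, a map on (an open part of) the half-space. -/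
def inChart (φ : M → Euc n) (p : M) : Euc k → Euc n :=
  φ ∘ (extChartAt (𝓡∂ k) p).symm

/-- The coordinate vector field `∂ᵢφ`, in the chart at `p`. Derivatives are taken within the
half-space, so they are one-sided at boundary points. -/
def coordField (φ : M → Euc n) (p : M) (i : Fin k) (y : Euc k) : Euc n :=
  fderivWithin ℝ (inChart k φ p) (range (𝓡∂ k)) y (EuclideanSpace.single i 1)

/-- The induced metric `g_{ij} = ⟨∂ᵢφ, ∂ⱼφ⟩`, in the chart at `p`. -/
def coordMetric (φ : M → Euc n) (p : M) (y : Euc k) : Matrix (Fin k) (Fin k) ℝ :=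
  Matrix.of fun i j => inner ℝ (coordField k φ p i y) (coordField k φ p j y)

/-- The second fundamental form `A(u, v) = (D_u V)^N` at `p`, where `V` is the tangent vector
field along `φ` that extends `v` with constant coefficients in the chart at `p`. -/
def secondFundamentalForm (φ : M → Euc n) (p : M) (u v : Euc k) : Euc n :=
  normalPart k φ p
    (fderivWithin ℝ (fderivWithin ℝ (inChart k φ p) (range (𝓡∂ k))) (range (𝓡∂ k))
      (extChartAt (𝓡∂ k) p p) u v)

/-- The mean curvature vector: the trace `∑ g^{ij} A(∂ᵢ, ∂ⱼ)` of the second fundamental form with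
respect to the induced metric. It equals `∑ A(eᵢ, eᵢ)` for every orthonormal basis `e` of the
tangent space, see `meanCurvature_eq_sum`. -/
def meanCurvature (φ : M → Euc n) (p : M) : Euc n :=
  ∑ i, ∑ j, ((coordMetric k φ p (extChartAt (𝓡∂ k) p p))⁻¹ i j) •
    secondFundamentalForm k φ p (EuclideanSpace.single i 1) (EuclideanSpace.single j 1)

/-- In the chart at `p`, the differential at `p` is the derivative of the coordinate expression. -/
theorem differential_eq {φ : M → Euc n} {p : M} (h : MDifferentiableAt (𝓡∂ k) 𝓘(ℝ, Euc n) φ p) :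
    differential k φ p =
      fderivWithin ℝ (inChart k φ p) (range (𝓡∂ k)) (extChartAt (𝓡∂ k) p p) :=
  h.mfderiv

/-- The mean curvature vector is the trace of the second fundamental form over any orthonormal basis
`dφ_p(e_1), …, dφ_p(e_k)` of the tangent space. -/
theorem meanCurvature_eq_sum {φ : M → Euc n} {p : M}
    (h : MDifferentiableAt (𝓡∂ k) 𝓘(ℝ, Euc n) φ p) (e : Fin k → Euc k)
    (he : Orthonormal ℝ fun i => differential k φ p (e i)) :
    meanCurvature k φ p = ∑ a, secondFundamentalForm k φ p (e a) (e a) := by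
  set G := coordMetric k φ p (extChartAt (𝓡∂ k) p p) with hG
  let P : Matrix (Fin k) (Fin k) ℝ := Matrix.of fun i a => e a i
  have hexp : ∀ a, e a = ∑ i, P i a • EuclideanSpace.single i (1 : ℝ) := by
    intro a
    ext j
    simp [P, Finset.sum_apply, Pi.single_apply]
  have hPG : P.transpose * (G * P) = 1 := by
    ext a b
    have hab := orthonormal_iff_ite.mp he a b
    rw [Matrix.one_apply, ← hab, differential_eq k h]
    simp only [Matrix.mul_apply, Matrix.transpose_apply, Finset.mul_sum]
    conv_rhs => rw [hexp a, hexp b]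
    simp only [map_sum, map_smul, sum_inner, inner_sum, inner_smul_left, inner_smul_right, hG,
      coordMetric, coordField, Matrix.of_apply, Finset.mul_sum]
    rw [Finset.sum_comm]
    refine Finset.sum_congr rfl fun i _ => Finset.sum_congr rfl fun j _ => ?_
    simp only [conj_trivial]
    ring
  have hinv : G⁻¹ = P * P.transpose := by
    apply Matrix.inv_eq_right_inv
    rw [← Matrix.mul_assoc]
    exact mul_eq_one_comm.mp hPG
  unfold meanCurvature
  rw [← hG, hinv]
  simp only [Matrix.mul_apply, Matrix.transpose_apply, Finset.sum_smul]
  have key : ∀ a, secondFundamentalForm k φ p (e a) (e a) = ∑ i, ∑ j, (P i a * P j a) •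
      secondFundamentalForm k φ p (EuclideanSpace.single i 1) (EuclideanSpace.single j 1) := by
    intro a
    unfold secondFundamentalForm
    conv_lhs => rw [hexp a]
    simp only [map_sum, map_smul, sum_apply, smul_apply,
      Finset.smul_sum, smul_smul]
    rw [Finset.sum_comm]
    refine Finset.sum_congr rfl fun i _ => Finset.sum_congr rfl fun j _ => ?_
    rw [mul_comm]
  simp only [key]
  conv_rhs => rw [Finset.sum_comm]
  refine Finset.sum_congr rfl fun i _ => ?_
  conv_rhs => rw [Finset.sum_comm]

/-- `ν` is the outward conormal of `∂M` at the boundary point `p`: the unit vector in the tangent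
space of `M` that is orthogonal to the tangent space of `∂M` and points out of `M`. -/
structure IsOutwardConormal (φ : M → Euc n) (p : M) (ν : Euc n) : Prop where
  outward : ∃ v : Euc k, v 0 < 0 ∧ differential k φ p v = ν
  orthogonal : ∀ w : Euc k, w 0 = 0 → inner ℝ ν (differential k φ p w) = 0
  unit : ‖ν‖ = 1

/-- `φ : M → 𝔹ⁿ` is an immersed free boundary minimal submanifold of the closed unit ball. -/
structure IsFreeBoundaryMinimal (φ : M → Euc n) : Prop where
  smooth : ContMDiff (𝓡∂ k) 𝓘(ℝ, Euc n) ∞ φ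
  immersion : ∀ p, Function.Injective (differential k φ p)
  mem_ball : ∀ p, φ p ∈ Metric.closedBall (0 : Euc n) 1
  boundary_mem_sphere : ∀ p ∈ (𝓡∂ k).boundary M, φ p ∈ Metric.sphere (0 : Euc n) 1
  minimal : ∀ p, meanCurvature k φ p = 0
  /-- The outward conormal is orthogonal to `T_{φ p}𝕊ⁿ⁻¹ = {w | ⟨φ p, w⟩ = 0}`. -/
  meets_orthogonally : ∀ p ∈ (𝓡∂ k).boundary M, ∃ ν, IsOutwardConormal k φ p ν ∧
    ∀ w : Euc n, inner ℝ (φ p) w = 0 → inner ℝ ν w = 0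

/-- The inclusion `ℝᵏ⁻¹ → ℝᵏ` of the hyperplane `{y | y 0 = 0}`. -/
def hyperplaneIncl (z : EuclideanSpace ℝ {i : Fin k // i ≠ 0}) : Euc k :=
  WithLp.toLp 2 fun i => if h : i = 0 then 0 else z ⟨i, h⟩

variable [MeasurableSpace M]

/-- The part of the induced `k`-dimensional measure that is carried by the domain of the chart at
`p`: the image of `√(det g) dy` under the inverse of the chart. -/
def chartVolume (φ : M → Euc n) (p : M) : Measure M :=
  ((volume.restrict (extChartAt (𝓡∂ k) p).target).withDensity fun y =>
    ENNReal.ofReal √(coordMetric k φ p y).det).map (extChartAt (𝓡∂ k) p).symm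

/-- The `k`-dimensional measure `da` induced by `φ` on `M`. The measures `chartVolume k φ p` agree
on the overlaps of charts, and `da` is their supremum, that is, the measure that restricts to
`chartVolume k φ p` on the domain of the chart at `p` for every `p`. -/
def inducedVolume (φ : M → Euc n) : Measure M :=
  ⨆ p : M, chartVolume k φ p

/-- The part of the induced `(k-1)`-dimensional measure of `∂M` that is carried by the domain of
the chart at `p`: the image of `√(det h) dz` under the inverse of the chart, where `h` is the
metric induced on `∂M`, that is, `h_{ij} = g_{ij}` for `i, j ≠ 0`. -/
def chartBoundaryVolume (φ : M → Euc n) (p : M) : Measure M :=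
  ((volume.restrict (hyperplaneIncl k ⁻¹' (extChartAt (𝓡∂ k) p).target)).withDensity fun z =>
    ENNReal.ofReal √((coordMetric k φ p (hyperplaneIncl k z)).submatrix
      (Subtype.val : {i : Fin k // i ≠ 0} → Fin k) Subtype.val).det).map
    fun z => (extChartAt (𝓡∂ k) p).symm (hyperplaneIncl k z)

/-- The `(k-1)`-dimensional measure `ds` induced by `φ` on `∂M`, as a measure on `M` that is
carried by `∂M`. -/
def inducedBoundaryVolume (φ : M → Euc n) : Measure M :=
  ⨆ p : M, chartBoundaryVolume k φ p

end

end FreeBoundary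

end

/-! Let x^⊤ be the tangential part of the position vector x = φ. The divergence of x along the
submanifold is `k`, and that of the normal part is minus the inner product of x with the mean
curvature vector, which is zero; hence div x^⊤ = k. Along the boundary, |x| = 1 and orthogonality
make x itself tangent to the submanifold, normal to the boundary and outward, so the flux of x^⊤ is
the volume of the boundary. The divergence theorem equates the two.

Since everything is defined through charts, the divergence theorem is proved by localisation. In a
chart, x^⊤ has coordinates c = g⁻¹(⟨x, ∂ᵢφ⟩), and √(det g) times the divergence of f x^⊤ is the
Euclidean divergence of √(det g) f c. Minimality turns this into √(det g)(k f + df(x^⊤))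
(`divergence_tangentCoord`, with `minimal_inChart` carrying the minimal surface equation to any
chart). On the hyperplane y 0 = 0 the free boundary condition gives √(det g) c₀ = -√(det h)
(`density_mul_chartCoord`). The divergence theorem on a half-space then yields, for f supported in
one chart, k ∫ f da + ∫ df(x^⊤) da = ∫ f ds (`integral_chart`).

The chart measures agree on overlaps by change of variables, so their supremum restricts to each of
them (`iSup_restrict_eq`) and the identity holds for the induced measures. Summing over a finite
partition of unity, Σ f = 1 and Σ df = 0, which leaves the claim. Finiteness comes for free, since 1
is a finite sum of integrable functions. -/

noncomputable section

namespace FreeBoundary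

/-! ### Linear algebra of the induced metric and of the tangential projection -/

section LinearAlgebra

variable {ι : Type*} [Fintype ι] [DecidableEq ι]

/-- Jacobi's formula for the derivative of a determinant. -/
theorem hasFDerivAt_det {E : Type*} [NormedAddCommGroup E] [NormedSpace ℝ E]
    {G : E → Matrix ι ι ℝ} {G' : ι → ι → E →L[ℝ] ℝ} {y : E}
    (h : ∀ i j, HasFDerivAt (fun z => G z i j) (G' i j) y) :
    HasFDerivAt (fun z => (G z).det) (∑ i, ∑ j, (G y).adjugate i j • G' j i) y := by
  have h1 : HasFDerivAt (fun z => (G z).det)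
      (∑ σ : Equiv.Perm ι, ((Equiv.Perm.sign σ : ℤ) : ℝ) •
        ∑ i, (∏ j ∈ Finset.univ.erase i, G y (σ j) j) • G' (σ i) i) y := by
    have : (fun z => (G z).det) = fun z => ∑ σ : Equiv.Perm ι,
        ((Equiv.Perm.sign σ : ℤ) : ℝ) • ∏ i, G z (σ i) i := by
      funext z
      rw [Matrix.det_apply']
      rfl
    rw [this]
    refine HasFDerivAt.fun_sum fun σ _ => HasFDerivAt.fun_const_smul ?_ _
    exact HasFDerivAt.finsetProd fun i _ => h (σ i) i
  refine h1.congr_fderiv ?_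
  ext v
  simp only [sum_apply, smul_apply, smul_eq_mul, Finset.mul_sum]
  rw [Finset.sum_comm]
  refine Finset.sum_congr rfl fun i _ => ?_
  -- By Cramer, a row of the adjugate paired with the derivative of column `i` is the determinant
  -- with that column replaced by its derivative.
  have h2 : ∑ j, (G y).adjugate i j * G' j i v = ((G y).updateCol i fun j => G' j i v).det := by
    rw [← Matrix.cramer_apply, Matrix.cramer_eq_adjugate_mulVec]
    rfl
  rw [h2, Matrix.det_apply']
  refine Finset.sum_congr rfl fun σ _ => ?_
  congr 1
  rw [← Finset.mul_prod_erase Finset.univ _ (Finset.mem_univ i), Matrix.updateCol_self, mul_comm]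
  congr 1
  refine Finset.prod_congr rfl fun j hj => ?_
  rw [Matrix.updateCol_ne (Finset.ne_of_mem_erase hj)]

variable {W : Type*} [NormedAddCommGroup W] [InnerProductSpace ℝ W]

/-- The matrix of the inner product pulled back by a linear map. -/
def metricOf (A : EuclideanSpace ℝ ι →L[ℝ] W) : Matrix ι ι ℝ :=
  Matrix.of fun i j => inner ℝ (A (EuclideanSpace.single i 1)) (A (EuclideanSpace.single j 1))

theorem euclidean_eq_sum (v : EuclideanSpace ℝ ι) :
    v = ∑ i, v i • EuclideanSpace.single i (1 : ℝ) := by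
  ext j
  simp [Finset.sum_apply, Pi.single_apply]

theorem map_eq_sum {V : Type*} [NormedAddCommGroup V] [NormedSpace ℝ V]
    (A : EuclideanSpace ℝ ι →L[ℝ] V) (v : EuclideanSpace ℝ ι) :
    A v = ∑ i, v i • A (EuclideanSpace.single i 1) := by
  conv_lhs => rw [euclidean_eq_sum v]
  simp

omit [Fintype ι] in
theorem metricOf_isSymm (A : EuclideanSpace ℝ ι →L[ℝ] W) : (metricOf A).IsSymm := by
  ext i j
  exact real_inner_comm _ _

theorem metricOf_comp (A : EuclideanSpace ℝ ι →L[ℝ] W)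
    (L : EuclideanSpace ℝ ι →L[ℝ] EuclideanSpace ℝ ι) :
    metricOf (A.comp L) =
      (Matrix.of fun i a => L (EuclideanSpace.single a 1) i).transpose * (metricOf A *
        Matrix.of fun i a => L (EuclideanSpace.single a 1) i) := by
  ext a b
  simp only [metricOf, Matrix.of_apply, ContinuousLinearMap.comp_apply]
  rw [map_eq_sum A (L _), map_eq_sum A (L (EuclideanSpace.single b 1))]
  simp only [sum_inner, inner_sum, inner_smul_left, inner_smul_right, Matrix.mul_apply,
    Matrix.transpose_apply, Matrix.of_apply, Finset.mul_sum, conj_trivial]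
  rw [Finset.sum_comm]
  refine Finset.sum_congr rfl fun i _ => Finset.sum_congr rfl fun j _ => ?_
  ring

theorem det_eq_det_of (L : EuclideanSpace ℝ ι →L[ℝ] EuclideanSpace ℝ ι) :
    L.det = (Matrix.of fun i a => L (EuclideanSpace.single a 1) i).det := by
  rw [ContinuousLinearMap.det,
    ← LinearMap.det_toMatrix (EuclideanSpace.basisFun ι ℝ).toBasis]
  congr 1

/-- The transformation rule of volume densities: with `A` the derivative of φ in one chart and `L`
that of a coordinate change, it makes the chart measures compatible, both on the manifold and on its
boundary. -/
theorem sqrt_det_metricOf_comp (A : EuclideanSpace ℝ ι →L[ℝ] W)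
    (L : EuclideanSpace ℝ ι →L[ℝ] EuclideanSpace ℝ ι) :
    √(metricOf (A.comp L)).det = |L.det| * √(metricOf A).det := by
  rw [metricOf_comp, Matrix.det_mul, Matrix.det_mul, Matrix.det_transpose, ← det_eq_det_of,
    ← Real.sqrt_sq_eq_abs, ← Real.sqrt_mul (sq_nonneg _)]
  congr 1
  ring

theorem posDef_metricOf {A : EuclideanSpace ℝ ι →L[ℝ] W} (hA : Function.Injective A) :
    (metricOf A).PosDef := by
  have h : LinearIndependent ℝ fun i => A (EuclideanSpace.single i (1 : ℝ)) := by
    have h1 := (EuclideanSpace.basisFun ι ℝ).toBasis.linearIndependent.map'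
      (A : EuclideanSpace ℝ ι →ₗ[ℝ] W) (LinearMap.ker_eq_bot.2 hA)
    have h2 : (fun i => A (EuclideanSpace.single i (1 : ℝ))) =
        (A : EuclideanSpace ℝ ι →ₗ[ℝ] W) ∘ (EuclideanSpace.basisFun ι ℝ).toBasis := by
      ext i
      simp
    rw [h2]
    exact h1
  exact Matrix.posDef_gram_of_linearIndependent h

theorem det_metricOf_pos {A : EuclideanSpace ℝ ι →L[ℝ] W} (hA : Function.Injective A) :
    0 < (metricOf A).det :=
  (posDef_metricOf hA).det_pos

/-- The coordinates of the tangential part of `w`. -/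
def tangentCoord (A : EuclideanSpace ℝ ι →L[ℝ] W) (w : W) : EuclideanSpace ℝ ι :=
  WithLp.toLp 2 ((metricOf A)⁻¹.mulVec fun i => inner ℝ w (A (EuclideanSpace.single i 1)))

/-- These are the normal equations of the orthogonal projection to the range of `A`. -/
theorem inner_sub_tangentCoord {A : EuclideanSpace ℝ ι →L[ℝ] W} (hA : Function.Injective A)
    (w : W) (v : EuclideanSpace ℝ ι) : inner ℝ (w - A (tangentCoord A w)) (A v) = 0 := by
  have h1 : ∀ j, inner ℝ (w - A (tangentCoord A w)) (A (EuclideanSpace.single j 1)) = 0 := by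
    intro j
    have h2 : (metricOf A).mulVec ((metricOf A)⁻¹.mulVec
        fun i => inner ℝ w (A (EuclideanSpace.single i 1))) j =
          inner ℝ w (A (EuclideanSpace.single j 1)) := by
      rw [Matrix.mulVec_mulVec, Matrix.mul_nonsing_inv _ (det_metricOf_pos hA).ne'.isUnit,
        Matrix.one_mulVec]
    rw [inner_sub_left, ← h2, map_eq_sum A (tangentCoord A w), sum_inner, Matrix.mulVec,
      dotProduct, sub_eq_zero]
    refine Finset.sum_congr rfl fun i _ => ?_
    rw [inner_smul_left, mul_comm, (metricOf_isSymm A).apply i j, conj_trivial]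
    rfl
  rw [map_eq_sum A v, inner_sum]
  exact Finset.sum_eq_zero fun i _ => by rw [inner_smul_right, h1, mul_zero]

theorem eq_tangentCoord {A : EuclideanSpace ℝ ι →L[ℝ] W} (hA : Function.Injective A)
    {w : W} {u : EuclideanSpace ℝ ι} (h : ∀ v, inner ℝ (w - A u) (A v) = 0) :
    u = tangentCoord A w := by
  apply hA
  rw [← sub_eq_zero, ← inner_self_eq_zero (𝕜 := ℝ)]
  have h1 := inner_sub_tangentCoord hA w (u - tangentCoord A w)
  have h2 := h (u - tangentCoord A w)
  rw [map_sub] at h1 h2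
  have : A u - A (tangentCoord A w) = (w - A (tangentCoord A w)) - (w - A u) := by abel
  conv_lhs => rw [this, inner_sub_left]
  rw [← this, h1, h2, sub_zero]

/-- The projection depends only on the range of `A`, which `L` does not change. Its coordinates
therefore transform like a tangent vector, so that x^⊤ is a vector field independent of charts. -/
theorem map_tangentCoord_comp {A : EuclideanSpace ℝ ι →L[ℝ] W} (hA : Function.Injective A)
    {L : EuclideanSpace ℝ ι →L[ℝ] EuclideanSpace ℝ ι} (hL : Function.Bijective L) (w : W) :
    L (tangentCoord (A.comp L) w) = tangentCoord A w := by
  refine eq_tangentCoord hA fun v => ?_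
  obtain ⟨v, rfl⟩ := hL.2 v
  exact inner_sub_tangentCoord (A := A.comp L) (hA.comp hL.1) w v

/-- If a unit vector `w` of the range of `A` is orthogonal to the image of the hyperplane `v 0 = 0`
and makes an obtuse angle with the image of `e₀`, then its coordinate in the direction of `e₀` is
minus the quotient of the volume densities of the hyperplane and of the whole space. -/
theorem sqrt_det_mul_tangentCoord_zero {k : ℕ} [NeZero k] {A : EuclideanSpace ℝ (Fin k) →L[ℝ] W}
    (hA : Function.Injective A) {w : W} (hw : ‖w‖ = 1) (hr : w ∈ range A)
    (h0 : ∀ i, i ≠ 0 → inner ℝ w (A (EuclideanSpace.single i 1)) = 0)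
    (hneg : inner ℝ w (A (EuclideanSpace.single 0 1)) ≤ 0) :
    √(metricOf A).det * tangentCoord A w 0 =
      -√((metricOf A).submatrix (Subtype.val : {i : Fin k // i ≠ 0} → Fin k) Subtype.val).det := by
  obtain ⟨m, rfl⟩ : ∃ m, k = m + 1 := Nat.exists_eq_succ_of_ne_zero (NeZero.ne k)
  have hadj : (metricOf A).adjugate 0 0 = ((metricOf A).submatrix
      (Subtype.val : {i : Fin (m + 1) // i ≠ 0} → Fin (m + 1)) Subtype.val).det := by
    rw [Matrix.adjugate_fin_succ_eq_det_submatrix,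
      ← Matrix.det_submatrix_equiv_self (finSuccAboveEquiv (0 : Fin (m + 1)))]
    simp
    rfl
  set d := (metricOf A).det with hd
  set c := ((metricOf A).submatrix
      (Subtype.val : {i : Fin (m + 1) // i ≠ 0} → Fin (m + 1)) Subtype.val).det with hc
  set a := inner ℝ w (A (EuclideanSpace.single 0 1)) with ha
  have hdpos : 0 < d := det_metricOf_pos hA
  -- Only ⟨w, A e₀⟩ is nonzero, so only the corner entry c / d of the inverse metric contributes.
  have hx : tangentCoord A w 0 = d⁻¹ * c * a := by
    change ((metricOf A)⁻¹.mulVec fun i => inner ℝ w (A (EuclideanSpace.single i 1))) 0 = _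
    rw [Matrix.mulVec, dotProduct, Finset.sum_eq_single 0]
    · rw [Matrix.inv_def, ← hadj, Ring.inverse_eq_inv', Matrix.smul_apply, smul_eq_mul]
    · intro i _ hi
      rw [h0 i hi, mul_zero]
    · simp
  -- Since `w` lies in the range, w = A u with u the tangent coordinates; pairing with `w` leaves u₀
  -- a = ‖w‖² = 1.
  have h1 : tangentCoord A w 0 * a = 1 := by
    obtain ⟨u, hu⟩ := hr
    have hu' : u = tangentCoord A w := eq_tangentCoord hA fun v => by rw [hu]; simp
    rw [hu'] at hu
    have h2 : inner ℝ w w = (1 : ℝ) := by rw [real_inner_self_eq_norm_sq, hw]; norm_num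
    nth_rw 2 [← hu] at h2
    rw [map_eq_sum A, inner_sum, Finset.sum_eq_single 0] at h2
    · rwa [inner_smul_right] at h2
    · intro i _ hi
      rw [inner_smul_right, h0 i hi, mul_zero]
    · simp
  have hca : c * a ^ 2 = d := by
    rw [hx] at h1
    field_simp at h1
    linarith
  have hane : a ≠ 0 := by rintro h; rw [h] at h1; simp at h1
  have haneg : a < 0 := lt_of_le_of_ne hneg hane
  have hcpos : 0 ≤ c := by
    by_contra h
    have : c * a ^ 2 ≤ 0 := mul_nonpos_of_nonpos_of_nonneg (le_of_not_ge h) (sq_nonneg a)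
    linarith
  have hs : √d = √c * (-a) := by
    rw [← hca, Real.sqrt_mul hcpos, Real.sqrt_sq_eq_abs, abs_of_neg haneg]
  have hx' : tangentCoord A w 0 = a⁻¹ := eq_inv_of_mul_eq_one_left h1
  rw [hs, hx']
  field_simp

end LinearAlgebra

/-! ### Gluing measures, and measures given by parametrizations -/

section Measures

/-- A compatible family of measures on the members of an open cover of a compact space is the
family of restrictions of its supremum. -/
theorem iSup_restrict_eq {M : Type*} [TopologicalSpace M] [CompactSpace M] [MeasurableSpace M]
    [BorelSpace M] {ι : Type*} (μ : ι → Measure M) (U : ι → Set M) (hU : ∀ i, IsOpen (U i))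
    (hcover : ⋃ i, U i = univ) (hsupp : ∀ i A, MeasurableSet A → μ i (A ∩ U i) = μ i A)
    (hcompat : ∀ i j A, MeasurableSet A → A ⊆ U i ∩ U j → μ i A = μ j A) (i : ι) :
    (⨆ j, μ j).restrict (U i) = μ i := by
  obtain ⟨t, ht⟩ := isCompact_univ.elim_finite_subcover U hU hcover.ge
  -- Listing the finite subcover orders it, so that it can be cut into disjoint measurable pieces.
  obtain ⟨l, hl⟩ : ∃ l : List ι, ∀ x, ∃ j ∈ l, x ∈ U j := by
    refine ⟨t.toList, fun x => ?_⟩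
    have := ht (mem_univ x)
    simp only [mem_iUnion] at this
    obtain ⟨j, hj, hx⟩ := this
    exact ⟨j, by simpa using hj, hx⟩
  let V : ℕ → Set M := fun m => if h : m < l.length then U (l.get ⟨m, h⟩) else ∅
  let E := disjointed V
  have hVm : ∀ m, MeasurableSet (V m) := by
    intro m
    by_cases h : m < l.length
    · simp only [V, h, dite_true]; exact (hU _).measurableSet
    · simp only [V, h, dite_false]; exact MeasurableSet.empty
  have hEm : ∀ m, MeasurableSet (E m) := fun m => MeasurableSet.disjointed hVm m
  have hEu : ⋃ m, E m = univ := by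
    rw [iUnion_disjointed, eq_univ_iff_forall]
    intro x
    obtain ⟨j, hj, hx⟩ := hl x
    obtain ⟨m, hm⟩ := List.get_of_mem hj
    exact mem_iUnion.2 ⟨m, by simp only [V, m.2, dite_true]; rw [hm]; exact hx⟩
  -- On the piece `E m` the measure of the `m`-th listed member dominates every `μ q`, with equality
  -- inside `U q`. Beyond the end of the list the pieces are empty and the value 0 is harmless.
  have hi : ∃ ν : ℕ → Measure M, ∀ m A, MeasurableSet A → A ⊆ E m →
      ∀ q, μ q A ≤ ν m A ∧ (A ⊆ U q → ν m A = μ q A) := by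
    refine ⟨fun m => if h : m < l.length then μ (l.get ⟨m, h⟩) else 0, fun m A hA hAE q => ?_⟩
    have hAV : A ⊆ V m := hAE.trans (disjointed_subset V m)
    by_cases h : m < l.length
    · simp only [V, h, dite_true] at hAV ⊢
      refine ⟨?_, fun hq => hcompat _ _ _ hA (subset_inter hAV hq)⟩
      rw [← hsupp q A hA, hcompat q (l.get ⟨m, h⟩) _ (hA.inter (hU q).measurableSet)
        (subset_inter inter_subset_right (inter_subset_left.trans hAV))]
      exact measure_mono inter_subset_left
    · simp only [V, h, dite_false] at hAV
      have : A = ∅ := subset_empty_iff.1 hAV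
      simp [this]
  obtain ⟨ν, hν⟩ := hi
  -- The glued measure is an upper bound of the family, hence dominates the supremum; inside `U i`
  -- it agrees with `μ i`, which gives the nontrivial inequality.
  let N : Measure M := Measure.sum fun m => (ν m).restrict (E m)
  have hdec : ∀ A, MeasurableSet A → ∀ κ : Measure M, κ A = ∑' m, κ (A ∩ E m) := by
    intro A hA κ
    rw [← measure_iUnion (fun a b hab => ((disjoint_disjointed V) hab).mono inter_subset_right
      inter_subset_right) (fun m => hA.inter (hEm m)), ← inter_iUnion, hEu, inter_univ]
  have hNA : ∀ A, MeasurableSet A → N A = ∑' m, ν m (A ∩ E m) := by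
    intro A hA
    rw [Measure.sum_apply _ hA]
    exact tsum_congr fun m => Measure.restrict_apply hA
  have hle : (⨆ j, μ j) ≤ N := by
    refine iSup_le fun q => Measure.le_iff.2 fun A hA => ?_
    rw [hNA A hA, hdec A hA]
    exact ENNReal.tsum_le_tsum fun m => (hν m _ (hA.inter (hEm m)) inter_subset_right q).1
  have hself : (μ i).restrict (U i) = μ i := by
    ext A hA
    rw [Measure.restrict_apply hA, hsupp i A hA]
  apply le_antisymm
  · refine Measure.le_iff.2 fun A hA => ?_
    rw [Measure.restrict_apply hA]
    refine (hle _).trans ?_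
    have hAU := hA.inter (hU i).measurableSet
    rw [hNA _ hAU, ← hsupp i A hA, hdec _ hAU]
    exact ENNReal.tsum_le_tsum fun m => ((hν m _ (hAU.inter (hEm m)) inter_subset_right i).2
      (inter_subset_left.trans inter_subset_right)).le
  · calc μ i = (μ i).restrict (U i) := hself.symm
      _ ≤ _ := Measure.restrict_mono subset_rfl (le_iSup μ i)

variable {M : Type*} [TopologicalSpace M] [MeasurableSpace M] [BorelSpace M]
  {E : Type*} [TopologicalSpace E] [MeasureSpace E] [BorelSpace E]

/-- The map is controlled only on `S`, outside of which an inverse chart has junk values;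
measurability is therefore checked on the subtype. -/
theorem measurableSet_inter_preimage {X : Type*} [TopologicalSpace X] [MeasurableSpace X]
    [OpensMeasurableSpace X] {S : Set X} (hS : MeasurableSet S) {a : X → M}
    (ha : ContinuousOn a S) {A : Set M} (hA : MeasurableSet A) : MeasurableSet (S ∩ a ⁻¹' A) := by
  have h1 : Measurable (S.domRestrict a) := (continuousOn_iff_continuous_domRestrict.1 ha).measurable
  have h2 := hS.subtype_image (h1 hA)
  convert h2 using 1
  ext x
  simp [and_comm, Set.domRestrict]

/-- The image of the measure with density `w` on `S` under a parametrization `a`. -/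
def paramMeasure (S : Set E) (w : E → ℝ) (a : E → M) : Measure M :=
  ((volume.restrict S).withDensity fun y => ENNReal.ofReal (w y)).map a

variable {S : Set E} {w : E → ℝ} {a : E → M}

theorem aemeasurable_param (hS : MeasurableSet S) (ha : ContinuousOn a S) :
    AEMeasurable a ((volume.restrict S).withDensity fun y => ENNReal.ofReal (w y)) :=
  (ha.aemeasurable hS).mono_ac (withDensity_absolutelyContinuous _ _)

theorem paramMeasure_apply (hS : MeasurableSet S) (ha : ContinuousOn a S) {A : Set M}
    (hA : MeasurableSet A) :
    paramMeasure S w a A = ∫⁻ y in S ∩ a ⁻¹' A, ENNReal.ofReal (w y) := by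
  have hm := measurableSet_inter_preimage hS ha hA
  rw [paramMeasure, Measure.map_apply_of_aemeasurable (aemeasurable_param hS ha) hA]
  have h1 : ((volume.restrict S).withDensity fun y => ENNReal.ofReal (w y)) (a ⁻¹' A) =
      ((volume.restrict S).withDensity fun y => ENNReal.ofReal (w y)) (S ∩ a ⁻¹' A) := by
    apply measure_congr
    have : ∀ᵐ y ∂((volume.restrict S).withDensity fun y => ENNReal.ofReal (w y)), y ∈ S :=
      withDensity_absolutelyContinuous _ _ (ae_restrict_mem hS)
    filter_upwards [this] with y hy
    apply propext
    exact ⟨fun h => ⟨hy, h⟩, fun h => h.2⟩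
  rw [h1, withDensity_apply _ hm, Measure.restrict_restrict hm]
  congr 2
  rw [inter_assoc, inter_comm _ S, ← inter_assoc, inter_self]

theorem paramMeasure_inter_eq (hS : MeasurableSet S) (ha : ContinuousOn a S) {U A : Set M}
    (hU : MeasurableSet U) (hSU : MapsTo a S U) (hA : MeasurableSet A) :
    paramMeasure S w a (A ∩ U) = paramMeasure S w a A := by
  rw [paramMeasure_apply hS ha hA, paramMeasure_apply hS ha (hA.inter hU)]
  congr 2
  ext y
  exact ⟨fun h => ⟨h.1, h.2.1⟩, fun h => ⟨h.1, h.2, hSU h.1⟩⟩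

/-- Change of variables between two parametrizations. -/
theorem paramMeasure_eq_of_transition {E : Type*} [NormedAddCommGroup E] [NormedSpace ℝ E]
    [FiniteDimensional ℝ E] [MeasureSpace E] [BorelSpace E] [(volume : Measure E).IsAddHaarMeasure]
    {S : Set E} {w : E → ℝ} {a : E → M} {T : Set E} {v : E → ℝ} {b : E → M}
    (hS : MeasurableSet S) (ha : ContinuousOn a S) (hT : MeasurableSet T) (hb : ContinuousOn b T)
    {A : Set M} (hA : MeasurableSet A) {τ : E → E} {τ' : E → E →L[ℝ] E}
    (hd : ∀ y ∈ S ∩ a ⁻¹' A, HasFDerivWithinAt τ (τ' y) (S ∩ a ⁻¹' A) y)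
    (hinj : InjOn τ (S ∩ a ⁻¹' A)) (him : τ '' (S ∩ a ⁻¹' A) = T ∩ b ⁻¹' A)
    (hw : ∀ y ∈ S ∩ a ⁻¹' A, w y = |(τ' y).det| * v (τ y)) :
    paramMeasure S w a A = paramMeasure T v b A := by
  rw [paramMeasure_apply hS ha hA, paramMeasure_apply hT hb hA, ← him,
    lintegral_image_eq_lintegral_abs_det_fderiv_mul _
      (measurableSet_inter_preimage hS ha hA) hd hinj]
  refine setLIntegral_congr_fun (measurableSet_inter_preimage hS ha hA) fun y hy => ?_
  rw [hw y hy, ENNReal.ofReal_mul (abs_nonneg _)]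

theorem integrable_paramMeasure_iff (hS : MeasurableSet S) (ha : ContinuousOn a S)
    (hwc : ContinuousOn w S) (hw : ∀ y ∈ S, 0 ≤ w y) {f : M → ℝ}
    (hf : AEStronglyMeasurable f (paramMeasure S w a)) :
    Integrable f (paramMeasure S w a) ↔ IntegrableOn (fun y => w y * f (a y)) S := by
  have hwm : AEMeasurable (fun y => w y) (volume.restrict S) := hwc.aemeasurable hS
  rw [paramMeasure] at hf ⊢
  rw [integrable_map_measure hf (aemeasurable_param hS ha),
    integrable_withDensity_iff_integrable_smul₀' hwm.ennreal_ofReal (by simp)]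
  refine integrable_congr ?_
  filter_upwards [ae_restrict_mem hS] with y hy
  simp [ENNReal.toReal_ofReal (hw y hy)]

theorem integral_paramMeasure (hS : MeasurableSet S) (ha : ContinuousOn a S)
    (hwc : ContinuousOn w S) (hw : ∀ y ∈ S, 0 ≤ w y) {f : M → ℝ}
    (hf : AEStronglyMeasurable f (paramMeasure S w a)) :
    ∫ x, f x ∂(paramMeasure S w a) = ∫ y in S, w y * f (a y) := by
  have hwm : AEMeasurable (fun y => w y) (volume.restrict S) := hwc.aemeasurable hS
  rw [paramMeasure] at hf ⊢
  rw [integral_map (aemeasurable_param hS ha) hf,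
    integral_withDensity_eq_integral_toReal_smul₀ hwm.ennreal_ofReal (by simp)]
  refine setIntegral_congr_fun hS fun y hy => ?_
  simp [ENNReal.toReal_ofReal (hw y hy)]

/-- Integration of a function that vanishes outside of the image of a parametrization. -/
theorem integrable_and_integral_eq {μ : Measure M} {U : Set M} (hU : MeasurableSet U)
    (hμ : μ.restrict U = paramMeasure S w a) (hS : MeasurableSet S) (ha : ContinuousOn a S)
    (hwc : ContinuousOn w S) (hw : ∀ y ∈ S, 0 ≤ w y) {f : M → ℝ}
    (hf : ContinuousOn f U) (hf0 : ∀ x, x ∉ U → f x = 0)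
    (hi : IntegrableOn (fun y => w y * f (a y)) S) :
    Integrable f μ ∧ ∫ x, f x ∂μ = ∫ y in S, w y * f (a y) := by
  have hm : AEStronglyMeasurable f (μ.restrict U) := hf.aestronglyMeasurable hU
  constructor
  · rw [← integrableOn_iff_integrable_of_support_subset (s := U), IntegrableOn, hμ,
      integrable_paramMeasure_iff hS ha hwc hw (hμ ▸ hm)]
    · exact hi
    · intro x hx
      by_contra h
      exact hx (hf0 x h)
  · rw [← setIntegral_eq_integral_of_forall_compl_eq_zero hf0, hμ,
      integral_paramMeasure hS ha hwc hw (hμ ▸ hm)]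

end Measures

/-! ### Coordinate changes on a manifold modelled on the half-space -/

section Charts

open Topology

theorem range_model (k : ℕ) [NeZero k] : range (𝓡∂ k) = {y : Euc k | 0 ≤ y 0} :=
  range_euclideanHalfSpace k

theorem interior_range_model (k : ℕ) [NeZero k] :
    interior (range (𝓡∂ k)) = {y : Euc k | 0 < y 0} := by
  rw [range_model, interior_halfSpace]

theorem uniqueDiffOn_range_model (k : ℕ) [NeZero k] : UniqueDiffOn ℝ (range (𝓡∂ k)) :=
  (𝓡∂ k).uniqueDiffOn

variable {k : ℕ} [NeZero k] {M : Type*} [TopologicalSpace M]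
  [ChartedSpace (EuclideanHalfSpace k) M]

/-- The coordinate change from the chart at `q` to the chart at `p`. -/
def transition (q p : M) : Euc k → Euc k :=
  extChartAt (𝓡∂ k) p ∘ (extChartAt (𝓡∂ k) q).symm

/-- The derivative of the coordinate change from the chart at `q` to the chart at `p`. -/
def transDeriv (q p : M) (y : Euc k) : Euc k →L[ℝ] Euc k :=
  fderivWithin ℝ (transition q p) (range (𝓡∂ k)) y

/-- The part of the chart at `q` that lies in the domain of the chart at `p`. -/
def overlap (q p : M) : Set (Euc k) :=
  (extChartAt (𝓡∂ k) q).target ∩ (extChartAt (𝓡∂ k) q).symm ⁻¹' (extChartAt (𝓡∂ k) p).source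

theorem symm_mem_source {q : M} {y : Euc k} (hy : y ∈ (extChartAt (𝓡∂ k) q).target) :
    (extChartAt (𝓡∂ k) q).symm y ∈ (extChartAt (𝓡∂ k) q).source :=
  (extChartAt (𝓡∂ k) q).map_target hy

theorem mem_overlap_symm {q : M} {y : Euc k} (hy : y ∈ (extChartAt (𝓡∂ k) q).target) :
    y ∈ overlap (k := k) q ((extChartAt (𝓡∂ k) q).symm y) :=
  ⟨hy, mem_extChartAt_source _⟩

variable {q p : M} {y : Euc k}

theorem symm_transition (hy : y ∈ overlap q p) :
    (extChartAt (𝓡∂ k) p).symm (transition q p y) = (extChartAt (𝓡∂ k) q).symm y :=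
  (extChartAt (𝓡∂ k) p).left_inv hy.2

theorem transition_mem_overlap (hy : y ∈ overlap q p) : transition q p y ∈ overlap p q := by
  refine ⟨(extChartAt (𝓡∂ k) p).map_source hy.2, ?_⟩
  rw [mem_preimage, symm_transition hy]
  exact symm_mem_source hy.1

theorem transition_transition (hy : y ∈ overlap q p) : transition p q (transition q p y) = y := by
  rw [transition, Function.comp_apply, symm_transition hy]
  exact (extChartAt (𝓡∂ k) q).right_inv hy.1

theorem mem_range_of_mem_target (hy : y ∈ (extChartAt (𝓡∂ k) q).target) : y ∈ range (𝓡∂ k) :=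
  extChartAt_target_subset_range q hy

theorem isClosed_range_model : IsClosed (range (𝓡∂ k)) := (𝓡∂ k).isClosed_range

theorem exists_isOpen_target (q : M) :
    ∃ O : Set (Euc k), IsOpen O ∧ (extChartAt (𝓡∂ k) q).target = O ∩ range (𝓡∂ k) :=
  ⟨_, (chartAt (EuclideanHalfSpace k) q).open_target.preimage (𝓡∂ k).continuous_symm,
    extChartAt_target (I := 𝓡∂ k) q⟩

theorem measurableSet_target (q : M) : MeasurableSet (extChartAt (𝓡∂ k) q).target := by
  obtain ⟨O, hO, h⟩ := exists_isOpen_target (k := k) q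
  rw [h]
  exact hO.measurableSet.inter isClosed_range_model.measurableSet

/-- Identities that hold on an overlap can thereby be differentiated within the half-space,
including at boundary points. -/
theorem overlap_mem_nhdsWithin (hy : y ∈ overlap q p) : overlap q p ∈ 𝓝[range (𝓡∂ k)] y := by
  refine Filter.inter_mem (extChartAt_target_mem_nhdsWithin_of_mem hy.1) ?_
  rw [← nhdsWithin_extChartAt_target_eq_of_mem hy.1]
  exact (continuousOn_extChartAt_symm q y hy.1).preimage_mem_nhdsWithin
    ((isOpen_extChartAt_source p).mem_nhds hy.2)

theorem range_mem_nhds (h0 : 0 < y 0) : range (𝓡∂ k) ∈ 𝓝 y := by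
  rw [← mem_interior_iff_mem_nhds, interior_range_model]
  exact h0

theorem target_mem_nhds (hy : y ∈ (extChartAt (𝓡∂ k) q).target) (h0 : 0 < y 0) :
    (extChartAt (𝓡∂ k) q).target ∈ 𝓝 y := by
  rw [← nhdsWithin_eq_nhds.2 (range_mem_nhds h0)]
  exact extChartAt_target_mem_nhdsWithin_of_mem hy

variable [IsManifold (𝓡∂ k) ∞ M]

theorem contDiffWithinAt_transition (hy : y ∈ overlap q p) :
    ContDiffWithinAt ℝ ∞ (transition q p) (range (𝓡∂ k)) y := by
  refine contDiffWithinAt_ext_coord_change p q ?_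
  rw [PartialEquiv.trans_source, PartialEquiv.symm_source]
  exact hy

theorem hasFDerivWithinAt_transition (hy : y ∈ overlap q p) :
    HasFDerivWithinAt (transition q p) (transDeriv q p y) (range (𝓡∂ k)) y :=
  ((contDiffWithinAt_transition hy).differentiableWithinAt (by simp)).hasFDerivWithinAt

theorem HasFDerivWithinAt.comp_transition {V : Type*} [NormedAddCommGroup V] [NormedSpace ℝ V]
    {g : Euc k → V} {g' : Euc k →L[ℝ] V} (hy : y ∈ overlap q p)
    (hg : HasFDerivWithinAt g g' (range (𝓡∂ k)) (transition q p y)) :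
    HasFDerivWithinAt (g ∘ transition q p) (g'.comp (transDeriv q p y)) (range (𝓡∂ k)) y := by
  -- The coordinate change is known to map into the half-space only on the overlap, so the chain
  -- rule is applied there and the result is then enlarged to the half-space.
  have h1 : HasFDerivWithinAt (transition q p) (transDeriv q p y) (overlap q p) y :=
    (hasFDerivWithinAt_transition hy).mono fun z hz => mem_range_of_mem_target hz.1
  exact (HasFDerivWithinAt.comp y hg h1 fun z hz =>
    mem_range_of_mem_target (transition_mem_overlap hz).1).mono_of_mem_nhdsWithin
      (overlap_mem_nhdsWithin hy)

/-- Differentiate the identity that the two coordinate changes are inverse to each other;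
derivatives within the half-space are unique. -/
theorem transDeriv_comp (hy : y ∈ overlap q p) :
    (transDeriv p q (transition q p y)).comp (transDeriv q p y) = .id ℝ (Euc k) := by
  have h1 := HasFDerivWithinAt.comp_transition hy
    (hasFDerivWithinAt_transition (transition_mem_overlap hy))
  have h2 : HasFDerivWithinAt (transition p q ∘ transition q p) (.id ℝ (Euc k))
      (range (𝓡∂ k)) y := by
    refine (hasFDerivWithinAt_id y _).congr_of_eventuallyEq ?_ (transition_transition hy)
    filter_upwards [overlap_mem_nhdsWithin hy] with z hz
    exact transition_transition hz
  exact (uniqueDiffOn_range_model k y (mem_range_of_mem_target hy.1)).eq h1 h2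

theorem transDeriv_bijective (hy : y ∈ overlap q p) :
    Function.Bijective (transDeriv q p y) := by
  have h1 := transDeriv_comp hy
  have h2 := transDeriv_comp (transition_mem_overlap hy)
  rw [transition_transition hy] at h2
  refine Function.bijective_iff_has_inverse.2 ⟨transDeriv p q (transition q p y), ?_, ?_⟩
  · exact fun v => DFunLike.congr_fun h1 v
  · exact fun v => DFunLike.congr_fun h2 v

theorem contDiffOn_inChart {V : Type*} [NormedAddCommGroup V] [NormedSpace ℝ V] {f : M → V}
    (hf : ContMDiff (𝓡∂ k) 𝓘(ℝ, V) ∞ f) (q : M) :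
    ContDiffOn ℝ ∞ (f ∘ (extChartAt (𝓡∂ k) q).symm) (extChartAt (𝓡∂ k) q).target :=
  contMDiffOn_iff_contDiffOn.1 (hf.comp_contMDiffOn (contMDiffOn_extChartAt_symm q))

theorem hasFDerivWithinAt_inChart {V : Type*} [NormedAddCommGroup V] [NormedSpace ℝ V] {f : M → V}
    (hf : ContMDiff (𝓡∂ k) 𝓘(ℝ, V) ∞ f) (hy : y ∈ (extChartAt (𝓡∂ k) q).target) :
    HasFDerivWithinAt (f ∘ (extChartAt (𝓡∂ k) q).symm)
      (fderivWithin ℝ (f ∘ (extChartAt (𝓡∂ k) q).symm) (range (𝓡∂ k)) y) (range (𝓡∂ k)) y :=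
  (((contDiffOn_inChart hf q y hy).differentiableWithinAt (by simp)).mono_of_mem_nhdsWithin
    (extChartAt_target_mem_nhdsWithin_of_mem hy)).hasFDerivWithinAt

omit [IsManifold (𝓡∂ k) ∞ M] in
theorem comp_symm_eventuallyEq {V : Type*} (f : M → V) (hy : y ∈ overlap q p) :
    f ∘ (extChartAt (𝓡∂ k) q).symm =ᶠ[𝓝[range (𝓡∂ k)] y]
      (f ∘ (extChartAt (𝓡∂ k) p).symm) ∘ transition q p := by
  filter_upwards [overlap_mem_nhdsWithin hy] with z hz
  simp only [Function.comp_apply, symm_transition hz]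

theorem fderivWithin_transition {V : Type*} [NormedAddCommGroup V] [NormedSpace ℝ V] {f : M → V}
    (hf : ContMDiff (𝓡∂ k) 𝓘(ℝ, V) ∞ f) (hy : y ∈ overlap q p) :
    fderivWithin ℝ (f ∘ (extChartAt (𝓡∂ k) q).symm) (range (𝓡∂ k)) y =
      (fderivWithin ℝ (f ∘ (extChartAt (𝓡∂ k) p).symm) (range (𝓡∂ k)) (transition q p y)).comp
        (transDeriv q p y) := by
  have h1 := HasFDerivWithinAt.comp_transition hy
    (hasFDerivWithinAt_inChart hf (transition_mem_overlap hy).1)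
  refine (h1.congr_of_eventuallyEq (comp_symm_eventuallyEq f hy) ?_).fderivWithin
    (uniqueDiffOn_range_model k y (mem_range_of_mem_target hy.1))
  simp only [Function.comp_apply, symm_transition hy]

omit [IsManifold (𝓡∂ k) ∞ M] in
theorem mfderiv_eq {V : Type*} [NormedAddCommGroup V] [NormedSpace ℝ V] {f : M → V}
    (hf : ContMDiff (𝓡∂ k) 𝓘(ℝ, V) ∞ f) (p : M) :
    mfderiv (𝓡∂ k) 𝓘(ℝ, V) f p = fderivWithin ℝ (f ∘ (extChartAt (𝓡∂ k) p).symm) (range (𝓡∂ k))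
      (extChartAt (𝓡∂ k) p p) :=
  ((hf p).mdifferentiableAt (by simp)).mfderiv

theorem symm_mem_boundary (hy : y ∈ (extChartAt (𝓡∂ k) q).target) (h0 : y 0 = 0) :
    (extChartAt (𝓡∂ k) q).symm y ∈ (𝓡∂ k).boundary M := by
  have hs : (extChartAt (𝓡∂ k) q).symm y ∈ (chartAt (EuclideanHalfSpace k) q).source := by
    rw [← extChartAt_source (𝓡∂ k)]
    exact symm_mem_source hy
  refine ((𝓡∂ k).isBoundaryPoint_iff_of_mem_atlas (n := ∞) (by simp)
    (chart_mem_atlas (EuclideanHalfSpace k) q) hs).2 ?_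
  change extChartAt (𝓡∂ k) q ((extChartAt (𝓡∂ k) q).symm y) ∈
    frontier (extChartAt (𝓡∂ k) q).target
  rw [(extChartAt (𝓡∂ k) q).right_inv hy]
  refine ⟨subset_closure hy, fun h => ?_⟩
  have := interior_mono (extChartAt_target_subset_range q) h
  rw [interior_range_model] at this
  exact this.ne' h0

/-- Being an interior point does not depend on the chart of the atlas. -/
theorem transition_zero_pos (hy : y ∈ overlap q p) (h0 : 0 < y 0) : 0 < transition q p y 0 := by
  have hs : (extChartAt (𝓡∂ k) q).symm y ∈ (chartAt (EuclideanHalfSpace k) q).source := by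
    rw [← extChartAt_source (𝓡∂ k)]
    exact symm_mem_source hy.1
  have hs' : (extChartAt (𝓡∂ k) q).symm y ∈ (chartAt (EuclideanHalfSpace k) p).source := by
    rw [← extChartAt_source (𝓡∂ k)]
    exact hy.2
  have h1 : (𝓡∂ k).IsInteriorPoint ((extChartAt (𝓡∂ k) q).symm y) := by
    refine ((𝓡∂ k).isInteriorPoint_iff_of_mem_atlas (n := ∞) (by simp)
      (chart_mem_atlas (EuclideanHalfSpace k) q) hs).2 ?_
    change extChartAt (𝓡∂ k) q ((extChartAt (𝓡∂ k) q).symm y) ∈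
      interior (extChartAt (𝓡∂ k) q).target
    rw [(extChartAt (𝓡∂ k) q).right_inv hy.1]
    exact mem_interior_iff_mem_nhds.2 (target_mem_nhds hy.1 h0)
  have h2 := ((𝓡∂ k).isInteriorPoint_iff_of_mem_atlas (n := ∞) (by simp)
      (chart_mem_atlas (EuclideanHalfSpace k) p) hs').1 h1
  have h3 := interior_mono (extChartAt_target_subset_range p) h2
  rw [interior_range_model] at h3
  exact h3

theorem transition_zero_eq (hy : y ∈ overlap q p) (h0 : y 0 = 0) : transition q p y 0 = 0 := by
  have h1 := mem_range_of_mem_target (transition_mem_overlap hy).1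
  rw [range_model] at h1
  refine le_antisymm (not_lt.1 fun h => ?_) h1
  have h2 := transition_zero_pos (transition_mem_overlap hy) h
  rw [transition_transition hy] at h2
  exact h2.ne' h0

/-- The line y + t v stays in the hyperplane, which coordinate changes preserve; hence the zeroth
coordinate of its image is constant for small t. -/
theorem transDeriv_zero_eq (hy : y ∈ overlap q p) (h0 : y 0 = 0) {v : Euc k} (hv : v 0 = 0) :
    transDeriv q p y v 0 = 0 := by
  have hline : HasDerivAt (fun t : ℝ => y + t • v) v 0 := by
    simpa using ((hasDerivAt_id (0 : ℝ)).smul_const v).const_add y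
  have hmem : ∀ t : ℝ, y + t • v ∈ range (𝓡∂ k) := by
    intro t
    rw [range_model]
    simp [h0, hv]
  have h1 : HasDerivAt (fun t : ℝ => transition q p (y + t • v)) (transDeriv q p y v) 0 := by
    have h2 : HasFDerivWithinAt (transition q p) (transDeriv q p y) (range (𝓡∂ k))
        (y + (0 : ℝ) • v) := by simpa using hasFDerivWithinAt_transition hy
    exact h2.comp_hasDerivAt (0 : ℝ) hline (Filter.Eventually.of_forall hmem)
  have h3 : HasDerivAt (fun t : ℝ => transition q p (y + t • v) 0) (transDeriv q p y v 0) 0 :=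
    (EuclideanSpace.proj (𝕜 := ℝ) (0 : Fin k)).hasFDerivAt.comp_hasDerivAt (0 : ℝ) h1
  have h4 : (fun t : ℝ => transition q p (y + t • v) 0) =ᶠ[𝓝 0] fun _ => 0 := by
    have h5 : Filter.Tendsto (fun t : ℝ => y + t • v) (𝓝 0) (𝓝[range (𝓡∂ k)] y) := by
      refine tendsto_nhdsWithin_iff.2 ⟨?_, Filter.Eventually.of_forall hmem⟩
      simpa using hline.continuousAt.tendsto
    filter_upwards [h5 (overlap_mem_nhdsWithin hy)] with t ht
    exact transition_zero_eq ht (by simp [h0, hv])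
  exact h3.unique ((hasDerivAt_const (0 : ℝ) (0 : ℝ)).congr_of_eventuallyEq h4)

end Charts

/-! ### The divergence of the tangential position field in coordinates -/

section Divergence

open Topology

variable {ι : Type*} [Fintype ι] [DecidableEq ι]
  {W : Type*} [NormedAddCommGroup W] [InnerProductSpace ℝ W]

local notation "e" i => (EuclideanSpace.single i (1 : ℝ))

theorem hasFDerivAt_metricOf {X : Type*} [NormedAddCommGroup X] [NormedSpace ℝ X]
    {D : X → EuclideanSpace ℝ ι →L[ℝ] W} {D' : X →L[ℝ] EuclideanSpace ℝ ι →L[ℝ] W} {y : X}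
    (hD : HasFDerivAt D D' y) (i j : ι) :
    HasFDerivAt (fun z => metricOf (D z) i j)
      ((innerSL ℝ (D y (e i))).comp (D'.flip (e j)) +
        (innerSL ℝ (D y (e j))).comp (D'.flip (e i))) y := by
  have h := fun i : ι => hD.clm_apply (hasFDerivAt_const (e i) y)
  refine ((h i).inner ℝ (h j)).congr_fderiv ?_
  ext v
  simp [real_inner_comm]

theorem differentiableAt_det {X : Type*} [NormedAddCommGroup X] [NormedSpace ℝ X]
    {G : X → Matrix ι ι ℝ} {y : X} (h : ∀ i j, DifferentiableAt ℝ (fun z => G z i j) y) :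
    DifferentiableAt ℝ (fun z => (G z).det) y :=
  (hasFDerivAt_det fun i j => (h i j).hasFDerivAt).differentiableAt

theorem differentiableAt_inv {X : Type*} [NormedAddCommGroup X] [NormedSpace ℝ X]
    {G : X → Matrix ι ι ℝ} {y : X} (h : ∀ i j, DifferentiableAt ℝ (fun z => G z i j) y)
    (h0 : (G y).det ≠ 0) (i j : ι) : DifferentiableAt ℝ (fun z => (G z)⁻¹ i j) y := by
  have h1 : (fun z => (G z)⁻¹ i j) = fun z => ((G z).det)⁻¹ *
      ((G z).updateRow j (Pi.single i 1)).det := by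
    funext z
    rw [Matrix.inv_def, Ring.inverse_eq_inv', Matrix.smul_apply, smul_eq_mul,
      Matrix.adjugate_apply]
  rw [h1]
  refine ((differentiableAt_det h).inv h0).mul (differentiableAt_det fun a b => ?_)
  by_cases hab : a = j
  · subst hab
    simp
  · simpa [Matrix.updateRow_ne hab] using h a b

theorem differentiableAt_metricOf (A : EuclideanSpace ℝ ι →L[ℝ] W) (i j : ι) :
    DifferentiableAt ℝ (fun B : EuclideanSpace ℝ ι →L[ℝ] W => metricOf B i j) A :=
  (hasFDerivAt_metricOf (hasFDerivAt_id A) i j).differentiableAt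

/-- Stated jointly in the linear map and the vector, this serves both for differentiating the field
in the interior and for its continuity up to the boundary, where only continuity of the first
derivatives of φ is at hand. -/
theorem differentiableAt_tangentCoord {A : EuclideanSpace ℝ ι →L[ℝ] W}
    (hA : Function.Injective A) (w : W) (j : ι) :
    DifferentiableAt ℝ (fun x : (EuclideanSpace ℝ ι →L[ℝ] W) × W => tangentCoord x.1 x.2 j)
      (A, w) := by
  have h1 : (fun x : (EuclideanSpace ℝ ι →L[ℝ] W) × W => tangentCoord x.1 x.2 j) = fun x =>
      ∑ i, (metricOf x.1)⁻¹ j i * inner ℝ x.2 (x.1 (e i)) := rfl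
  rw [h1]
  refine DifferentiableAt.fun_sum fun i _ => DifferentiableAt.fun_mul ?_ ?_
  · refine differentiableAt_inv (G := fun x : (EuclideanSpace ℝ ι →L[ℝ] W) × W => metricOf x.1)
      (y := (A, w)) (fun a b => ?_) (det_metricOf_pos hA).ne' j i
    exact DifferentiableAt.comp (f := Prod.fst) (A, w) (differentiableAt_metricOf A a b)
      differentiableAt_fst
  · exact differentiableAt_snd.inner ℝ (differentiableAt_fst.clm_apply
      (differentiableAt_const _))

theorem differentiableAt_sqrt_det {A : EuclideanSpace ℝ ι →L[ℝ] W} (hA : Function.Injective A) :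
    DifferentiableAt ℝ (fun B : EuclideanSpace ℝ ι →L[ℝ] W => √(metricOf B).det) A :=
  (differentiableAt_det (differentiableAt_metricOf A)).sqrt (det_metricOf_pos hA).ne'

/-- The derivative of the volume density of a parametrization. -/
theorem hasFDerivAt_sqrt_det {X : Type*} [NormedAddCommGroup X] [NormedSpace ℝ X]
    {D : X → EuclideanSpace ℝ ι →L[ℝ] W} {D' : X →L[ℝ] EuclideanSpace ℝ ι →L[ℝ] W} {y : X}
    (hD : HasFDerivAt D D' y) (hinj : Function.Injective (D y)) :
    HasFDerivAt (fun z => √(metricOf (D z)).det)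
      (√(metricOf (D y)).det • ∑ a, ∑ b, (metricOf (D y))⁻¹ a b •
        (innerSL ℝ (D y (e a))).comp (D'.flip (e b))) y := by
  have hpos := det_metricOf_pos hinj
  refine ((hasFDerivAt_det fun i j => hasFDerivAt_metricOf hD i j).sqrt hpos.ne').congr_fderiv ?_
  have hadj : ∀ a b, (metricOf (D y)).adjugate a b =
      (metricOf (D y)).det * (metricOf (D y))⁻¹ a b := by
    intro a b
    rw [Matrix.inv_def, Ring.inverse_eq_inv', Matrix.smul_apply, smul_eq_mul,
      mul_inv_cancel_left₀ hpos.ne']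
  have hsymm : ∀ a b, (metricOf (D y))⁻¹ a b = (metricOf (D y))⁻¹ b a := fun a b =>
    ((metricOf_isSymm (D y)).inv).apply b a
  ext v
  simp only [sum_apply, smul_apply, add_apply,
    ContinuousLinearMap.comp_apply, ContinuousLinearMap.flip_apply, smul_eq_mul, hadj,
    innerSL_apply_apply, mul_add, Finset.sum_add_distrib]
  -- The two halves of the derivative of g contribute equally because g⁻¹ is symmetric; the
  -- resulting 2 cancels the one in the derivative of the square root.
  have h1 : ∑ a, ∑ b, (metricOf (D y)).det * (metricOf (D y))⁻¹ a b *
      inner ℝ (D y (e b)) (D' v (e a)) = ∑ a, ∑ b, (metricOf (D y)).det *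
        (metricOf (D y))⁻¹ a b * inner ℝ (D y (e a)) (D' v (e b)) := by
    rw [Finset.sum_comm]
    refine Finset.sum_congr rfl fun a _ => Finset.sum_congr rfl fun b _ => ?_
    rw [hsymm]
  rw [h1]
  simp only [mul_assoc, ← Finset.mul_sum]
  have h2 := Real.sq_sqrt hpos.le
  have h3 : √(metricOf (D y)).det ≠ 0 := (Real.sqrt_pos.2 hpos).ne'
  set s := √(metricOf (D y)).det
  rw [← h2]
  field_simp
  ring

/-- The divergence of the tangential part of the position vector of a minimal immersion, multiplied
by a function `u`. -/
theorem divergence_tangentCoord {F : EuclideanSpace ℝ ι → W} {y : EuclideanSpace ℝ ι}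
    (hF : ContDiffAt ℝ 2 F y) (hinj : ∀ᶠ z in 𝓝 y, Function.Injective (fderiv ℝ F z))
    (hmin : ∀ N : W, (∀ v, inner ℝ N (fderiv ℝ F y v) = 0) →
      ∑ i, ∑ j, (metricOf (fderiv ℝ F y))⁻¹ i j *
        inner ℝ N (fderiv ℝ (fderiv ℝ F) y (e i) (e j)) = 0)
    {u : EuclideanSpace ℝ ι → ℝ} {u' : EuclideanSpace ℝ ι →L[ℝ] ℝ} (hu : HasFDerivAt u u' y) :
    ∃ V' : ι → EuclideanSpace ℝ ι →L[ℝ] ℝ,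
      (∀ j, HasFDerivAt (fun z => √(metricOf (fderiv ℝ F z)).det *
        (u z * tangentCoord (fderiv ℝ F z) (F z) j)) (V' j) y) ∧
      ∑ j, V' j (e j) = √(metricOf (fderiv ℝ F y)).det *
        (Fintype.card ι * u y + u' (tangentCoord (fderiv ℝ F y) (F y))) := by
  have hiy := hinj.self_of_nhds
  have hFd : HasFDerivAt F (fderiv ℝ F y) y := (hF.differentiableAt (by norm_num)).hasFDerivAt
  have hDd : HasFDerivAt (fderiv ℝ F) (fderiv ℝ (fderiv ℝ F) y) y :=
    ((hF.fderiv_right (m := 1) (by norm_num)).differentiableAt (by norm_num)).hasFDerivAt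
  have hsym : ∀ v w, fderiv ℝ (fderiv ℝ F) y v w = fderiv ℝ (fderiv ℝ F) y w v :=
    hF.isSymmSndFDerivAt (by simp)
  set D := fderiv ℝ F y with hDdef
  set D2 := fderiv ℝ (fderiv ℝ F) y with hD2
  set g := metricOf D with hg
  set c := tangentCoord D (F y) with hc
  have hcd : ∀ j, DifferentiableAt ℝ (fun z => tangentCoord (fderiv ℝ F z) (F z) j) y := fun j =>
    (differentiableAt_tangentCoord hiy (F y) j).comp (f := fun z => (fderiv ℝ F z, F z)) y
      (hDd.differentiableAt.prodMk hFd.differentiableAt)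
  choose c' hc' using hcd
  have hsq := hasFDerivAt_sqrt_det hDd hiy
  refine ⟨_, fun j => hsq.mul (hu.mul (hc' j)), ?_⟩
  -- the orthogonality relations and their derivatives
  have horth : ∀ l v, inner ℝ (D v - ∑ i, (c' i v • D (e i) + c i • D2 v (e i))) (D (e l)) +
      inner ℝ (F y - D c) (D2 v (e l)) = 0 := by
    intro l v
    have h1 : HasFDerivAt (fun z => F z - ∑ i, tangentCoord (fderiv ℝ F z) (F z) i •
        fderiv ℝ F z (e i)) (D - ∑ i, (c i • D2.flip (e i) + (c' i).smulRight (D (e i)))) y := by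
      refine hFd.sub (HasFDerivAt.fun_sum fun i _ => ?_)
      refine ((hc' i).smul (hDd.clm_apply (hasFDerivAt_const (e i) y))).congr_fderiv ?_
      ext w
      simp [hc, hDdef]
    have h2 := h1.inner ℝ (hDd.clm_apply (hasFDerivAt_const (e l) y))
    have h3 : (fun z => inner ℝ (F z - ∑ i, tangentCoord (fderiv ℝ F z) (F z) i •
        fderiv ℝ F z (e i)) (fderiv ℝ F z (e l))) =ᶠ[𝓝 y] fun _ => (0 : ℝ) := by
      filter_upwards [hinj] with z hz
      rw [← map_eq_sum]
      exact inner_sub_tangentCoord hz _ _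
    have h4 := h2.unique ((hasFDerivAt_const (0 : ℝ) y).congr_of_eventuallyEq h3)
    have h5 := DFunLike.congr_fun h4 v
    have h6 : ∑ i, c i • D (e i) = D c := (map_eq_sum D c).symm
    simp only [fderivInnerCLM_apply, ContinuousLinearMap.comp_apply,
      ContinuousLinearMap.prod_apply, sub_apply, sum_apply, add_apply, smul_apply,
      ContinuousLinearMap.flip_apply, ContinuousLinearMap.smulRight_apply,
      zero_apply, ← hDdef, ← hc, h6, map_zero, zero_add] at h5
    rw [add_comm] at h5
    simp only [add_comm (c _ • D2 _ _) _] at h5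
    simpa using h5
  -- Minimality is tested against the normal part of the position vector.
  have hmin' := hmin (F y - D c) fun v => inner_sub_tangentCoord hiy (F y) v
  have hgg : ∀ i j, ∑ l, g i l * g⁻¹ l j = if i = j then 1 else 0 := fun i j => by
    rw [← Matrix.mul_apply, Matrix.mul_nonsing_inv _ (det_metricOf_pos hiy).ne'.isUnit,
      Matrix.one_apply]
  have hB : ∀ X : ι → ι → ℝ, ∑ l, ∑ j, g⁻¹ l j * ∑ i, X i j * g i l = ∑ j, X j j := by
    intro X
    rw [Finset.sum_comm]
    refine Finset.sum_congr rfl fun j _ => ?_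
    simp only [Finset.mul_sum]
    rw [Finset.sum_comm]
    have : ∀ i, ∑ l, g⁻¹ l j * (X i j * g i l) = X i j * if i = j then 1 else 0 := by
      intro i
      rw [← hgg, Finset.mul_sum]
      exact Finset.sum_congr rfl fun l _ => by ring
    simp [this]
  -- Put v = e_j in `horth` and contract with g⁻¹. The terms become the dimension, the sum of ∂ⱼcⱼ,
  -- the logarithmic derivative of √(det g) along c, and a trace of the second derivative against
  -- the normal part, which vanishes by `hmin'`. Hence div x^⊤ is the dimension.
  have hkey : (Fintype.card ι : ℝ) - ∑ j, c' j (e j) -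
      ∑ i, c i * ∑ a, ∑ b, g⁻¹ a b * inner ℝ (D (e a)) (D2 (e i) (e b)) = 0 := by
    have h1 := hB fun i j => if i = j then 1 else 0
    have h2 := hB fun i j => c' i (e j)
    have h3 : ∑ i, c i * ∑ a, ∑ b, g⁻¹ a b * inner ℝ (D (e a)) (D2 (e i) (e b)) =
        ∑ l, ∑ j, g⁻¹ l j * ∑ i, c i * inner ℝ (D2 (e j) (e i)) (D (e l)) := by
      simp only [Finset.mul_sum]
      rw [Finset.sum_comm]
      refine Finset.sum_congr rfl fun a _ => ?_
      rw [Finset.sum_comm]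
      refine Finset.sum_congr rfl fun b _ => Finset.sum_congr rfl fun i _ => ?_
      rw [hsym, real_inner_comm]
      ring
    rw [h3, ← h2]
    have h4 : (Fintype.card ι : ℝ) = ∑ l, ∑ j, g⁻¹ l j * g j l := by
      simpa using h1.symm
    rw [h4, ← neg_eq_zero, ← Finset.sum_sub_distrib, ← Finset.sum_sub_distrib, ← hmin',
      ← sub_eq_zero, ← Finset.sum_neg_distrib, ← Finset.sum_sub_distrib]
    refine Finset.sum_eq_zero fun l _ => ?_
    rw [← Finset.sum_sub_distrib, ← Finset.sum_sub_distrib, ← Finset.sum_neg_distrib,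
      ← Finset.sum_sub_distrib]
    refine Finset.sum_eq_zero fun j _ => ?_
    have h5 := horth l (e j)
    rw [inner_sub_left, sum_inner] at h5
    simp only [inner_add_left, inner_smul_left, conj_trivial, Finset.sum_add_distrib] at h5
    have h6 : inner ℝ (F y - D c) (D2 (e l) (e j)) =
        -(g j l - (∑ i, c' i (e j) * g i l + ∑ i, c i * inner ℝ (D2 (e j) (e i)) (D (e l)))) := by
      rw [hsym]
      exact eq_neg_of_add_eq_zero_right h5
    rw [h6]
    ring
  have hu' : u' c = ∑ j, c j * u' (e j) := map_eq_sum u' c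
  simp only [add_apply, smul_apply, smul_eq_mul, sum_apply, ContinuousLinearMap.comp_apply,
    ContinuousLinearMap.flip_apply, innerSL_apply_apply]
  rw [hu']
  have hk : (Fintype.card ι : ℝ) = ∑ j, c' j (e j) +
      ∑ i, c i * ∑ a, ∑ b, g⁻¹ a b * inner ℝ (D (e a)) (D2 (e i) (e b)) := by linarith
  rw [hk, ← Finset.sum_add_distrib, Finset.sum_mul, ← Finset.sum_add_distrib, Finset.mul_sum]
  refine Finset.sum_congr rfl fun j _ => ?_
  ring

end Divergence

/-! ### Minimality in an arbitrary chart -/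

section Minimality

open Topology

local notation "e" i => (EuclideanSpace.single i (1 : ℝ))

/-- In the second-order chain rule the second derivative of the coordinate change enters only
through the range of the differential of `F`, so it is invisible to normal vectors. -/
theorem fderiv_fderiv_comp {E G W : Type*} [NormedAddCommGroup E] [NormedSpace ℝ E]
    [NormedAddCommGroup G] [NormedSpace ℝ G] [NormedAddCommGroup W] [NormedSpace ℝ W]
    {F : G → W} {τ : E → G} {y : E} (hF : ContDiffAt ℝ 2 F (τ y)) (hτ : ContDiffAt ℝ 2 τ y)
    (u v : E) :
    fderiv ℝ (fderiv ℝ (F ∘ τ)) y u v =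
      fderiv ℝ (fderiv ℝ F) (τ y) (fderiv ℝ τ y u) (fderiv ℝ τ y v) +
        fderiv ℝ F (τ y) (fderiv ℝ (fderiv ℝ τ) y u v) := by
  have h1 : fderiv ℝ (F ∘ τ) =ᶠ[𝓝 y] fun z => (fderiv ℝ F (τ z)).comp (fderiv ℝ τ z) := by
    filter_upwards [hτ.continuousAt.eventually (hF.eventually (by simp)),
      hτ.eventually (by simp)] with z hz1 hz2
    exact fderiv_comp z (hz1.differentiableAt (by simp)) (hz2.differentiableAt (by simp))
  have h2 : HasFDerivAt (fderiv ℝ F) (fderiv ℝ (fderiv ℝ F) (τ y)) (τ y) :=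
    ((hF.fderiv_right (m := 1) (by norm_num)).differentiableAt (by norm_num)).hasFDerivAt
  have h3 : HasFDerivAt (fderiv ℝ τ) (fderiv ℝ (fderiv ℝ τ) y) y :=
    ((hτ.fderiv_right (m := 1) (by norm_num)).differentiableAt (by norm_num)).hasFDerivAt
  have h4 := (h2.comp y (hτ.differentiableAt (by simp)).hasFDerivAt).clm_comp h3
  rw [h1.fderiv_eq]
  have h5 : fderiv ℝ (fun z => (fderiv ℝ F (τ z)).comp (fderiv ℝ τ z)) y = _ := h4.fderiv
  rw [h5]
  simp [add_comm]

/-- The trace of a bilinear form with respect to the induced metric does not depend on the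
parametrization. -/
theorem trace_comp {ι : Type*} [Fintype ι] [DecidableEq ι] {W : Type*} [NormedAddCommGroup W]
    [InnerProductSpace ℝ W] {A : EuclideanSpace ℝ ι →L[ℝ] W} (hA : Function.Injective A)
    {L : EuclideanSpace ℝ ι →L[ℝ] EuclideanSpace ℝ ι} (hL : Function.Injective L)
    (B : EuclideanSpace ℝ ι →L[ℝ] EuclideanSpace ℝ ι →L[ℝ] ℝ) :
    ∑ i, ∑ j, (metricOf (A.comp L))⁻¹ i j * B (L (e i)) (L (e j)) =
      ∑ i, ∑ j, (metricOf A)⁻¹ i j * B (e i) (e j) := by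
  set P : Matrix ι ι ℝ := Matrix.of fun i a => L (e a) i with hP
  have hAL : IsUnit (metricOf (A.comp L)).det :=
    (det_metricOf_pos (A := A.comp L) (hA.comp hL)).ne'.isUnit
  have hg : metricOf (A.comp L) = P.transpose * (metricOf A * P) := metricOf_comp A L
  have hPu : IsUnit P.det := by
    rw [hg, Matrix.det_mul, Matrix.det_mul] at hAL
    exact isUnit_of_mul_isUnit_right (isUnit_of_mul_isUnit_right hAL)
  -- The inverse metric transforms contravariantly, which cancels the covariant factors of `B`.
  have hinv : P * (metricOf (A.comp L))⁻¹ * P.transpose = (metricOf A)⁻¹ := by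
    have hPt : IsUnit P.transpose.det := by rwa [Matrix.det_transpose]
    rw [hg, Matrix.mul_inv_rev, Matrix.mul_inv_rev, ← Matrix.mul_assoc, ← Matrix.mul_assoc,
      Matrix.mul_nonsing_inv _ hPu, Matrix.one_mul, Matrix.mul_assoc,
      Matrix.nonsing_inv_mul _ hPt, Matrix.mul_one]
  have hB : ∀ i j, B (L (e i)) (L (e j)) = ∑ a, ∑ b, P a i * P b j * B (e a) (e b) := by
    intro i j
    rw [map_eq_sum B (L (e i))]
    simp only [sum_apply, smul_apply]
    refine Finset.sum_congr rfl fun a _ => ?_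
    rw [map_eq_sum (B (e a)) (L (e j)), smul_eq_mul, Finset.mul_sum]
    exact Finset.sum_congr rfl fun b _ => by simp only [smul_eq_mul, hP, Matrix.of_apply]; ring
  have h1 : ∀ a b, (metricOf A)⁻¹ a b =
      ∑ i, ∑ j, P a i * (metricOf (A.comp L))⁻¹ i j * P b j := by
    intro a b
    rw [← hinv, Matrix.mul_apply, Finset.sum_comm]
    refine Finset.sum_congr rfl fun j _ => ?_
    rw [Matrix.mul_apply, Finset.sum_mul]
    rfl
  simp only [h1, hB, Finset.mul_sum, Finset.sum_mul]
  calc _ = ∑ i, ∑ a, ∑ j, ∑ b, (metricOf (A.comp L))⁻¹ i j * (P a i * P b j * B (e a) (e b)) :=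
        Finset.sum_congr rfl fun i _ => Finset.sum_comm
    _ = ∑ a, ∑ i, ∑ b, ∑ j, (metricOf (A.comp L))⁻¹ i j * (P a i * P b j * B (e a) (e b)) := by
        rw [Finset.sum_comm]
        exact Finset.sum_congr rfl fun a _ => Finset.sum_congr rfl fun i _ => Finset.sum_comm
    _ = _ := by
        refine Finset.sum_congr rfl fun a _ => ?_
        rw [Finset.sum_comm]
        refine Finset.sum_congr rfl fun b _ => Finset.sum_congr rfl fun i _ =>
          Finset.sum_congr rfl fun j _ => ?_
        ring

variable {k n : ℕ} [NeZero k] {M : Type*} [TopologicalSpace M]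
  [ChartedSpace (EuclideanHalfSpace k) M] [IsManifold (𝓡∂ k) ∞ M]
  {φ : M → Euc n} {q p : M} {y : Euc k}

omit [IsManifold (𝓡∂ k) ∞ M] in
theorem inChart_def : inChart k φ q = φ ∘ (extChartAt (𝓡∂ k) q).symm := rfl

omit [TopologicalSpace M] [ChartedSpace (EuclideanHalfSpace k) M] [IsManifold (𝓡∂ k) ∞ M] in
theorem fderivWithin_range_eventuallyEq {V : Type*} [NormedAddCommGroup V] [NormedSpace ℝ V]
    (F : Euc k → V) (h0 : 0 < y 0) :
    fderivWithin ℝ F (range (𝓡∂ k)) =ᶠ[𝓝 y] fderiv ℝ F := by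
  have h1 : {z : Euc k | 0 < z 0} ∈ 𝓝 y := by
    rw [← interior_range_model]
    exact isOpen_interior.mem_nhds (by rwa [interior_range_model])
  filter_upwards [h1] with z hz
  exact fderivWithin_of_mem_nhds (range_mem_nhds hz)

theorem contDiffAt_inChart {V : Type*} [NormedAddCommGroup V] [NormedSpace ℝ V] {f : M → V}
    (hf : ContMDiff (𝓡∂ k) 𝓘(ℝ, V) ∞ f) (hy : y ∈ (extChartAt (𝓡∂ k) q).target) (h0 : 0 < y 0) :
    ContDiffAt ℝ ∞ (f ∘ (extChartAt (𝓡∂ k) q).symm) y :=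
  (contDiffOn_inChart hf q).contDiffAt (target_mem_nhds hy h0)

theorem differential_comp_transDeriv (hφ : IsFreeBoundaryMinimal k φ)
    (hy : y ∈ (extChartAt (𝓡∂ k) q).target) :
    fderivWithin ℝ (inChart k φ q) (range (𝓡∂ k)) y =
      (differential k φ ((extChartAt (𝓡∂ k) q).symm y)).comp
        (transDeriv q ((extChartAt (𝓡∂ k) q).symm y) y) := by
  rw [inChart_def, fderivWithin_transition hφ.smooth (mem_overlap_symm hy), differential,
    mfderiv_eq hφ.smooth]
  rfl

theorem fderivWithin_inChart_injective (hφ : IsFreeBoundaryMinimal k φ)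
    (hy : y ∈ (extChartAt (𝓡∂ k) q).target) :
    Function.Injective (fderivWithin ℝ (inChart k φ q) (range (𝓡∂ k)) y) := by
  rw [differential_comp_transDeriv hφ hy]
  exact (hφ.immersion _).comp (transDeriv_bijective (mem_overlap_symm hy)).1

omit [IsManifold (𝓡∂ k) ∞ M] in
theorem coordMetric_eq (φ : M → Euc n) (q : M) (y : Euc k) :
    coordMetric k φ q y = metricOf (fderivWithin ℝ (inChart k φ q) (range (𝓡∂ k)) y) := rfl

/-- The equation of minimal submanifolds, in an arbitrary chart. -/
theorem minimal_inChart (hφ : IsFreeBoundaryMinimal k φ)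
    (hy : y ∈ (extChartAt (𝓡∂ k) q).target) (h0 : 0 < y 0) {N : Euc n}
    (hN : ∀ v, inner ℝ N (fderiv ℝ (inChart k φ q) y v) = 0) :
    ∑ i, ∑ j, (metricOf (fderiv ℝ (inChart k φ q) y))⁻¹ i j *
      inner ℝ N (fderiv ℝ (fderiv ℝ (inChart k φ q)) y (e i) (e j)) = 0 := by
  -- The mean curvature at a point is defined in the preferred chart at that point, so the chart at
  -- `q` is compared with the chart at the point over `y`.
  have hov := mem_overlap_symm hy
  set p := (extChartAt (𝓡∂ k) q).symm y with hp
  have hz : transition q p y = extChartAt (𝓡∂ k) p p := rfl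
  have hz0 := transition_zero_pos hov h0
  have hzt := (transition_mem_overlap hov).1
  have hL : transDeriv q p y = fderiv ℝ (transition q p) y :=
    fderivWithin_of_mem_nhds (range_mem_nhds h0)
  have hFp : ContDiffAt ℝ 2 (inChart k φ p) (transition q p y) :=
    (contDiffAt_inChart hφ.smooth hzt hz0).of_le (by norm_cast)
  have hτ : ContDiffAt ℝ 2 (transition q p) y :=
    ((contDiffWithinAt_transition hov).contDiffAt (range_mem_nhds h0)).of_le (by norm_cast)
  have heq : inChart k φ q =ᶠ[𝓝 y] inChart k φ p ∘ transition q p := by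
    have := comp_symm_eventuallyEq φ hov
    rwa [nhdsWithin_eq_nhds.2 (range_mem_nhds h0)] at this
  have hD : fderiv ℝ (inChart k φ q) y =
      (fderiv ℝ (inChart k φ p) (transition q p y)).comp (transDeriv q p y) := by
    rw [heq.fderiv_eq, fderiv_comp y (hFp.differentiableAt (by simp))
      (hτ.differentiableAt (by simp)), hL]
  have hLb := transDeriv_bijective hov
  have hN' : ∀ v, inner ℝ N (fderiv ℝ (inChart k φ p) (transition q p y) v) = 0 := by
    intro v
    obtain ⟨v, rfl⟩ := hLb.2 v
    have := hN v
    rwa [hD] at this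
  have hdiff : differential k φ p = fderiv ℝ (inChart k φ p) (transition q p y) := by
    rw [differential, mfderiv_eq hφ.smooth, ← hz]
    exact fderivWithin_of_mem_nhds (range_mem_nhds hz0)
  have hD2 : ∀ u v, inner ℝ N (fderiv ℝ (fderiv ℝ (inChart k φ q)) y u v) =
      ((innerSL ℝ N).comp
        ((fderiv ℝ (fderiv ℝ (inChart k φ p)) (transition q p y)) (transDeriv q p y u)))
          (transDeriv q p y v) := by
    intro u v
    rw [heq.fderiv.fderiv_eq, fderiv_fderiv_comp hFp hτ, inner_add_right, hN', add_zero, hL]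
    rfl
  let B : Euc k →L[ℝ] Euc k →L[ℝ] ℝ := (ContinuousLinearMap.compL ℝ (Euc k) (Euc n) ℝ
    (innerSL ℝ N)).comp (fderiv ℝ (fderiv ℝ (inChart k φ p)) (transition q p y))
  have hinj : Function.Injective (fderiv ℝ (inChart k φ p) (transition q p y)) :=
    hdiff ▸ hφ.immersion p
  have h1 := trace_comp hinj hLb.1 B
  simp only [hD2]
  rw [hD]
  refine h1.trans ?_
  -- the mean curvature vector at `p`
  have h2 : inner ℝ N (meanCurvature k φ p) = (0 : ℝ) := by rw [hφ.minimal, inner_zero_right]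
  have hNp : N ∈ (tangentPlane k φ p)ᗮ := by
    rw [Submodule.mem_orthogonal']
    rintro _ ⟨v, rfl⟩
    have := hN' v
    rwa [← hdiff] at this
  -- The vector N is normal, so pairing with it does not see the tangential part of w.
  have h3 : ∀ w, inner ℝ N (normalPart k φ p w) = inner ℝ N w := by
    intro w
    rw [← sub_eq_zero, ← inner_sub_right, real_inner_comm, ← neg_sub, inner_neg_left,
      normalPart, Submodule.starProjection_inner_eq_zero _ _ hNp, neg_zero]
  have h4 : fderivWithin ℝ (fderivWithin ℝ (inChart k φ p) (range (𝓡∂ k))) (range (𝓡∂ k))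
      (extChartAt (𝓡∂ k) p p) = fderiv ℝ (fderiv ℝ (inChart k φ p)) (transition q p y) := by
    rw [← hz, fderivWithin_of_mem_nhds (range_mem_nhds hz0),
      (fderivWithin_range_eventuallyEq _ hz0).fderiv_eq]
  rw [meanCurvature, inner_sum] at h2
  rw [← h2]
  refine Finset.sum_congr rfl fun i _ => ?_
  rw [inner_sum]
  refine Finset.sum_congr rfl fun j _ => ?_
  rw [inner_smul_right, secondFundamentalForm, h3, h4, coordMetric_eq, ← hz,
    fderivWithin_of_mem_nhds (range_mem_nhds hz0)]
  rfl

end Minimality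

/-! ### The divergence theorem on the half-space -/

section HalfSpace

open Topology

/-- The divergence theorem on a half-space, for vector fields with bounded support. -/
theorem integral_divergence_halfSpace_pi {m : ℕ} (V : Fin (m + 1) → (Fin (m + 1) → ℝ) → ℝ)
    (h : (Fin (m + 1) → ℝ) → ℝ) {R : ℝ} (hR : 0 < R)
    (hc : ∀ i, ContinuousOn (V i) {x | 0 ≤ x 0})
    (hV : ∀ x, 0 ≤ x 0 → (∃ i, R ≤ |x i|) → ∀ j, V j x = 0)
    (hh : ∀ x, 0 ≤ x 0 → (∃ i, R ≤ |x i|) → h x = 0)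
    (hd : ∀ x, 0 < x 0 → ∃ V' : Fin (m + 1) → (Fin (m + 1) → ℝ) →L[ℝ] ℝ,
      (∀ j, HasFDerivAt (V j) (V' j) x) ∧ ∑ j, V' j (Pi.single j 1) = h x)
    (hi : IntegrableOn h {x | 0 ≤ x 0}) :
    ∫ x in {x | 0 ≤ x 0}, h x = -∫ z : Fin m → ℝ, V 0 ((0 : Fin (m + 1)).insertNth 0 z) := by
  -- The theorem for boxes wants derivatives as a function of every point; the value 0 outside the
  -- open half-space is never used.
  have hd' : ∀ x, ∃ V' : Fin (m + 1) → (Fin (m + 1) → ℝ) →L[ℝ] ℝ, 0 < x 0 →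
      (∀ j, HasFDerivAt (V j) (V' j) x) ∧ ∑ j, V' j (Pi.single j 1) = h x := by
    intro x
    by_cases hx : 0 < x 0
    · obtain ⟨V', hV'⟩ := hd x hx
      exact ⟨V', fun _ => hV'⟩
    · exact ⟨0, fun h => absurd h hx⟩
  choose V' hV' using hd'
  -- The box [0, R] × [-R, R]^m has one face in the boundary hyperplane, and the fields vanish on
  -- all the others.
  let a : Fin (m + 1) → ℝ := Fin.cons 0 fun _ => -R
  let b : Fin (m + 1) → ℝ := fun _ => R
  have ha0 : a 0 = 0 := rfl
  have has : ∀ i : Fin m, a i.succ = -R := fun i => rfl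
  have hab : a ≤ b := fun i => by
    refine Fin.cases ?_ (fun i => ?_) i
    · rw [ha0]; exact hR.le
    · rw [has]; simp only [b]; linarith
  have hIcc : Icc a b ⊆ {x | 0 ≤ x 0} := fun x hx => hx.1 0
  have hIoo : ∀ x ∈ pi univ fun i => Ioo (a i) (b i), 0 < x 0 := fun x hx => (hx 0 (mem_univ 0)).1
  -- Derivatives exist only in the open box, but its complement in the closed box is a null set.
  have hae : ∀ᵐ x ∂(volume.restrict (Icc a b)), ∑ j, V' x j (Pi.single j 1) = h x := by
    rw [← Measure.restrict_congr_set (μ := volume) (Measure.univ_pi_Ioo_ae_eq_Icc (f := a) (g := b))]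
    filter_upwards [ae_restrict_mem (MeasurableSet.univ_pi fun i => measurableSet_Ioo)] with x hx
    exact (hV' x (hIoo x hx)).2
  have hdiv := integral_divergence_of_hasFDerivAt_off_countable' a b hab V (fun i x => V' x i) ∅
    countable_empty (fun i => (hc i).mono hIcc)
    (fun x hx i => (hV' x (hIoo x hx.1)).1 i)
    ((hi.mono_set hIcc).congr (hae.mono fun x hx => hx.symm))
  rw [integral_congr_ae hae] at hdiv
  have hfar : ∀ x : Fin (m + 1) → ℝ, 0 ≤ x 0 → x ∉ Icc a b → ∃ i, R ≤ |x i| := by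
    intro x h0 hx
    by_contra hcon
    push Not at hcon
    refine hx ⟨fun i => ?_, fun i => (abs_lt.1 (hcon i)).2.le⟩
    revert hcon
    refine Fin.cases (fun _ => h0) (fun i hcon => ?_) i
    rw [has]
    exact (abs_lt.1 (hcon _)).1.le
  have hleft : ∫ x in {x : Fin (m + 1) → ℝ | 0 ≤ x 0}, h x = ∫ x in Icc a b, h x :=
    setIntegral_eq_of_subset_of_forall_sdiff_eq_zero
      (measurableSet_le measurable_const (measurable_pi_apply 0)) hIcc
      fun x hx => hh x hx.1 (hfar x hx.1 hx.2)
  rw [hleft, hdiv, Finset.sum_eq_single 0]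
  · have h1 : ∫ x in Icc (a ∘ (0 : Fin (m + 1)).succAbove) (b ∘ (0 : Fin (m + 1)).succAbove),
        V 0 ((0 : Fin (m + 1)).insertNth (b 0) x) = 0 := by
      refine (setIntegral_congr_fun measurableSet_Icc fun x hx => ?_).trans
        (integral_zero (Fin m → ℝ) ℝ)
      refine hV _ ?_ ⟨0, ?_⟩ 0
      · simp [b, hR.le]
      · simp [b, le_abs_self]
    have h2 : ∫ x in Icc (a ∘ (0 : Fin (m + 1)).succAbove) (b ∘ (0 : Fin (m + 1)).succAbove),
        V 0 ((0 : Fin (m + 1)).insertNth (a 0) x) =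
          ∫ z : Fin m → ℝ, V 0 ((0 : Fin (m + 1)).insertNth 0 z) := by
      refine setIntegral_eq_integral_of_forall_compl_eq_zero fun x hx => ?_
      refine hV _ (by simp [ha0]) (hfar _ (by simp [ha0]) fun hmem => hx ⟨fun i => ?_, fun i => ?_⟩) 0
      · simpa using hmem.1 i.succ
      · simpa using hmem.2 i.succ
    rw [h1, h2, zero_sub]
  · intro i _ hi0
    have hrange : ∀ x ∈ Icc (a ∘ i.succAbove) (b ∘ i.succAbove), ∀ t : ℝ,
        0 ≤ (i.insertNth t x : Fin (m + 1) → ℝ) 0 := by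
      intro x hx t
      obtain ⟨j, hj⟩ := Fin.exists_succAbove_eq hi0.symm
      rw [← hj, Fin.insertNth_apply_succAbove]
      have := hx.1 j
      rwa [Function.comp_apply, hj] at this
    have hz : ∀ t : ℝ, |t| = R → ∫ x in Icc (a ∘ i.succAbove) (b ∘ i.succAbove),
        V i (i.insertNth t x) = 0 := by
      intro t ht
      refine (setIntegral_congr_fun measurableSet_Icc fun x hx => ?_).trans
        (integral_zero (Fin m → ℝ) ℝ)
      exact hV _ (hrange x hx t) ⟨i, by simp [ht]⟩ i
    obtain ⟨j, rfl⟩ := Fin.exists_succ_eq_of_ne_zero hi0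
    rw [hz _ (abs_of_pos hR), hz _ (by rw [has, abs_neg, abs_of_pos hR]), sub_zero]
  · simp

theorem integral_divergence_halfSpace {k : ℕ} [NeZero k] (V : Fin k → Euc k → ℝ) (h : Euc k → ℝ)
    {K : Set (Euc k)} (hK : Bornology.IsBounded K)
    (hc : ∀ i, ContinuousOn (V i) {x | 0 ≤ x 0})
    (hV : ∀ x, 0 ≤ x 0 → x ∉ K → ∀ j, V j x = 0)
    (hh : ∀ x, 0 ≤ x 0 → x ∉ K → h x = 0)
    (hd : ∀ x, 0 < x 0 → ∃ V' : Fin k → Euc k →L[ℝ] ℝ,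
      (∀ j, HasFDerivAt (V j) (V' j) x) ∧ ∑ j, V' j (EuclideanSpace.single j 1) = h x)
    (hi : IntegrableOn h {x | 0 ≤ x 0}) :
    ∫ x in {x | 0 ≤ x 0}, h x = -∫ z, V 0 (hyperplaneIncl k z) := by
  obtain ⟨m, rfl⟩ : ∃ m, k = m + 1 := Nat.exists_eq_succ_of_ne_zero (NeZero.ne k)
  obtain ⟨R, hR⟩ := hK.subset_ball 0
  -- If `K` is empty, `R` need not be positive; `max R 1` is.
  have hRx : ∀ x ∈ K, ∀ i, |x i| < max R 1 := by
    intro x hx i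
    have h1 : ‖x i‖ ≤ ‖x‖ := PiLp.norm_apply_le x i
    have h2 : ‖x‖ < R := by simpa using hR hx
    exact (h1.trans_lt h2).trans_le (le_max_left _ _)
  have hfar : ∀ x : Euc (m + 1), (∃ i, max R 1 ≤ |x i|) → x ∉ K := fun x ⟨i, hix⟩ hx =>
    (hRx x hx i).not_ge hix
  let L : (Fin (m + 1) → ℝ) ≃L[ℝ] Euc (m + 1) :=
    (PiLp.continuousLinearEquiv 2 ℝ fun _ : Fin (m + 1) => ℝ).symm
  have hmp : MeasurePreserving (L : (Fin (m + 1) → ℝ) → Euc (m + 1)) volume volume :=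
    PiLp.volume_preserving_toLp (Fin (m + 1))
  have hme : MeasurableEmbedding (L : (Fin (m + 1) → ℝ) → Euc (m + 1)) :=
    L.toHomeomorph.measurableEmbedding
  have hset : L ⁻¹' {x : Euc (m + 1) | 0 ≤ x 0} = {x : Fin (m + 1) → ℝ | 0 ≤ x 0} := rfl
  have hmain := integral_divergence_halfSpace_pi (fun i x => V i (L x)) (fun x => h (L x))
    (lt_max_of_lt_right one_pos : 0 < max R 1)
    (fun i => (hc i).comp L.continuous.continuousOn fun x hx => hx)
    (fun x h0 hx => hV _ h0 (hfar _ hx)) (fun x h0 hx => hh _ h0 (hfar _ hx))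
    (fun x h0 => by
      obtain ⟨V', h1, h2⟩ := hd (L x) h0
      refine ⟨fun j => (V' j).comp (L : (Fin (m + 1) → ℝ) →L[ℝ] Euc (m + 1)),
        fun j => (h1 j).comp x L.hasFDerivAt, ?_⟩
      rw [← h2]
      rfl)
    ((hmp.integrableOn_comp_preimage hme).2 hi)
  rw [← hset, hmp.setIntegral_preimage_emb hme h] at hmain
  rw [hmain]
  congr 1
  -- the two models of the hyperplane
  let σ := finSuccAboveEquiv (0 : Fin (m + 1))
  have hmp1 : MeasurePreserving (MeasurableEquiv.piCongrLeft (fun _ => ℝ) σ) volume volume :=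
    volume_measurePreserving_piCongrLeft (fun _ : {i : Fin (m + 1) // i ≠ 0} => ℝ) σ
  have hmp2 : MeasurePreserving
      (MeasurableEquiv.toLp 2 ({i : Fin (m + 1) // i ≠ 0} → ℝ)) volume volume :=
    PiLp.volume_preserving_toLp _
  rw [← hmp2.integral_comp', ← hmp1.integral_comp']
  refine integral_congr_ae (Filter.Eventually.of_forall fun x => ?_)
  simp only
  congr 1
  ext i
  refine Fin.cases ?_ (fun j => ?_) i
  · simp [hyperplaneIncl, L]
  · have h1 : (⟨j.succ, Fin.succ_ne_zero j⟩ : {i : Fin (m + 1) // i ≠ 0}) = σ j := by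
      ext
      simp [σ, finSuccAboveEquiv_apply]
    have h2 : hyperplaneIncl (m + 1) ((MeasurableEquiv.toLp 2 ({i : Fin (m + 1) // i ≠ 0} → ℝ))
        ((MeasurableEquiv.piCongrLeft (fun _ => ℝ) σ) x)) j.succ =
        (MeasurableEquiv.piCongrLeft (fun _ => ℝ) σ) x ⟨j.succ, Fin.succ_ne_zero j⟩ := by
      simp [hyperplaneIncl, Fin.succ_ne_zero]
    rw [h2, h1]
    refine Eq.trans ?_ (Equiv.piCongrLeft_apply_apply (fun _ => ℝ) σ x j).symm
    simp [L]

end HalfSpace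

/-! ### Densities, the tangential field and the free boundary condition in charts -/

section ChartIntegrals

open Topology

/-- The inclusion of the hyperplane `{y | y 0 = 0}`, as a continuous linear map. -/
def inclL (k : ℕ) [NeZero k] : EuclideanSpace ℝ {i : Fin k // i ≠ 0} →L[ℝ] Euc k :=
  LinearMap.toContinuousLinearMap
    { toFun := hyperplaneIncl k
      map_add' := fun x y => by
        ext i
        by_cases h : i = 0 <;> simp [hyperplaneIncl, h]
      map_smul' := fun c x => by
        ext i
        by_cases h : i = 0 <;> simp [hyperplaneIncl, h] }

/-- The projection to the hyperplane `{y | y 0 = 0}`. -/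
def projL (k : ℕ) [NeZero k] : Euc k →L[ℝ] EuclideanSpace ℝ {i : Fin k // i ≠ 0} :=
  LinearMap.toContinuousLinearMap
    { toFun := fun y => WithLp.toLp 2 fun i => y i
      map_add' := fun _ _ => rfl
      map_smul' := fun _ _ => rfl }

variable {k n : ℕ} [NeZero k]

@[simp] theorem inclL_apply (z : EuclideanSpace ℝ {i : Fin k // i ≠ 0}) :
    inclL k z = hyperplaneIncl k z := rfl

theorem continuous_hyperplaneIncl : Continuous (hyperplaneIncl k) := (inclL k).continuous

@[simp] theorem hyperplaneIncl_zero (z : EuclideanSpace ℝ {i : Fin k // i ≠ 0}) :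
    hyperplaneIncl k z 0 = 0 := by
  simp [hyperplaneIncl]

@[simp] theorem projL_hyperplaneIncl (z : EuclideanSpace ℝ {i : Fin k // i ≠ 0}) :
    projL k (hyperplaneIncl k z) = z := by
  ext i
  have : (projL k (hyperplaneIncl k z)) i = hyperplaneIncl k z i := rfl
  rw [this]
  simp [hyperplaneIncl, i.2]

theorem hyperplaneIncl_projL {y : Euc k} (hy : y 0 = 0) : hyperplaneIncl k (projL k y) = y := by
  ext i
  by_cases h : i = 0
  · subst h
    simp [hy]
  · simp only [hyperplaneIncl, h, dite_false]
    rfl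

theorem hyperplaneIncl_single (i : {i : Fin k // i ≠ 0}) :
    hyperplaneIncl k (EuclideanSpace.single i 1) = EuclideanSpace.single (i : Fin k) (1 : ℝ) := by
  ext j
  by_cases h : j = 0
  · subst h
    simp [hyperplaneIncl, i.2.symm]
  · simp [hyperplaneIncl, h, Subtype.ext_iff]

/-- The boundary metric is that of the restricted differential, so the general facts on `metricOf`
apply to the boundary density too. -/
theorem metricOf_inclL {W : Type*} [NormedAddCommGroup W] [InnerProductSpace ℝ W]
    (A : Euc k →L[ℝ] W) : metricOf (A.comp (inclL k)) =
      (metricOf A).submatrix (Subtype.val : {i : Fin k // i ≠ 0} → Fin k) Subtype.val := by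
  ext i j
  simp [metricOf, hyperplaneIncl_single]

variable {M : Type*} [TopologicalSpace M]
  [ChartedSpace (EuclideanHalfSpace k) M]

/-- The coordinates of the tangential part of the position vector, in the chart at `q`. -/
def chartCoord (φ : M → Euc n) (q : M) (y : Euc k) : Euc k :=
  tangentCoord (fderivWithin ℝ (inChart k φ q) (range (𝓡∂ k)) y) (inChart k φ q y)

/-- The tangential part of the position vector, as a vector field on `M`. -/
def tangentField (φ : M → Euc n) (p : M) : Euc k :=
  tangentCoord (differential k φ p) (φ p)

/-- The derivative of `f` in the direction of the tangential part of the position vector. -/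
def derivAlong (φ : M → Euc n) (f : M → ℝ) (p : M) : ℝ :=
  (mfderiv (𝓡∂ k) 𝓘(ℝ, ℝ) f p : Euc k →L[ℝ] ℝ) (tangentField φ p)

/-- The volume density in the chart at `q`. -/
def density (φ : M → Euc n) (q : M) (y : Euc k) : ℝ := √(coordMetric k φ q y).det

/-- The volume density of the boundary in the chart at `q`. -/
def boundaryDensity (φ : M → Euc n) (q : M) (z : EuclideanSpace ℝ {i : Fin k // i ≠ 0}) : ℝ :=
  √((coordMetric k φ q (hyperplaneIncl k z)).submatrix
      (Subtype.val : {i : Fin k // i ≠ 0} → Fin k) Subtype.val).det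

theorem boundaryDensity_eq (φ : M → Euc n) (q : M) (z : EuclideanSpace ℝ {i : Fin k // i ≠ 0}) :
    boundaryDensity φ q z = √(metricOf ((fderivWithin ℝ (inChart k φ q) (range (𝓡∂ k))
      (hyperplaneIncl k z)).comp (inclL k))).det := by
  rw [metricOf_inclL]
  rfl

theorem derivAlong_eq_zero (φ : M → Euc n) {f : M → ℝ} {p : M} (hp : p ∉ tsupport f) :
    derivAlong (k := k) φ f p = 0 := by
  have h : f =ᶠ[𝓝 p] fun _ => 0 := by
    have h1 := notMem_tsupport_iff_eventuallyEq.1 hp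
    exact h1
  rw [derivAlong, h.mfderiv_eq, mfderiv_const]
  rfl

variable [IsManifold (𝓡∂ k) ∞ M] {φ : M → Euc n} {q : M} {y : Euc k}

/-- The differential of f and the coordinates of x^⊤ transform oppositely, so their pairing may be
computed in the chart at `q` instead of the preferred chart at the point. -/
theorem derivAlong_symm (hφ : IsFreeBoundaryMinimal k φ) {f : M → ℝ}
    (hf : ContMDiff (𝓡∂ k) 𝓘(ℝ, ℝ) ∞ f) (hy : y ∈ (extChartAt (𝓡∂ k) q).target) :
    derivAlong (k := k) φ f ((extChartAt (𝓡∂ k) q).symm y) =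
      fderivWithin ℝ (f ∘ (extChartAt (𝓡∂ k) q).symm) (range (𝓡∂ k)) y (chartCoord φ q y) := by
  have hov := mem_overlap_symm hy
  rw [fderivWithin_transition hf hov, ContinuousLinearMap.comp_apply, chartCoord,
    differential_comp_transDeriv hφ hy]
  have h1 : inChart k φ q y = φ ((extChartAt (𝓡∂ k) q).symm y) := rfl
  rw [h1, map_tangentCoord_comp (hφ.immersion _) (transDeriv_bijective hov), derivAlong,
    mfderiv_eq hf]
  rfl

theorem continuousOn_fderivWithin_inChart {V : Type*} [NormedAddCommGroup V] [NormedSpace ℝ V]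
    {f : M → V} (hf : ContMDiff (𝓡∂ k) 𝓘(ℝ, V) ∞ f) (q : M) :
    ContinuousOn (fderivWithin ℝ (f ∘ (extChartAt (𝓡∂ k) q).symm) (range (𝓡∂ k)))
      (extChartAt (𝓡∂ k) q).target := by
  -- The derivative within the target is continuous, and it coincides with that within the
  -- half-space because the target is relatively open.
  refine ((contDiffOn_inChart hf q).continuousOn_fderivWithin
    (uniqueDiffOn_extChartAt_target q) (by simp)).congr fun y hy => ?_
  refine (fderivWithin_congr_set' y ?_).symm
  have h1 := nhdsWithin_extChartAt_target_eq_of_mem (I := 𝓡∂ k) hy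
  refine Filter.EventuallyEq.filter_mono (nhdsWithin_eq_iff_eventuallyEq.1 h1) nhdsWithin_le_nhds

theorem continuousOn_density (hφ : IsFreeBoundaryMinimal k φ) (q : M) :
    ContinuousOn (density φ q) (extChartAt (𝓡∂ k) q).target := fun y hy =>
  (differentiableAt_sqrt_det
    (fderivWithin_inChart_injective hφ hy)).continuousAt.comp_continuousWithinAt
      (continuousOn_fderivWithin_inChart hφ.smooth q y hy)

theorem continuousOn_chartCoord (hφ : IsFreeBoundaryMinimal k φ) (q : M) (j : Fin k) :
    ContinuousOn (fun y => chartCoord φ q y j) (extChartAt (𝓡∂ k) q).target := fun y hy =>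
  ContinuousAt.comp_continuousWithinAt
    (f := fun y => (fderivWithin ℝ (inChart k φ q) (range (𝓡∂ k)) y, inChart k φ q y))
    (differentiableAt_tangentCoord (fderivWithin_inChart_injective hφ hy)
      (inChart k φ q y) j).continuousAt
    ((continuousOn_fderivWithin_inChart hφ.smooth q y hy).prodMk
      ((contDiffOn_inChart hφ.smooth q).continuousOn y hy))

theorem continuousOn_derivAlong_symm (hφ : IsFreeBoundaryMinimal k φ) {f : M → ℝ}
    (hf : ContMDiff (𝓡∂ k) 𝓘(ℝ, ℝ) ∞ f) (q : M) :
    ContinuousOn (fun y => derivAlong (k := k) φ f ((extChartAt (𝓡∂ k) q).symm y))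
      (extChartAt (𝓡∂ k) q).target := by
  have h1 : ContinuousOn (chartCoord φ q) (extChartAt (𝓡∂ k) q).target := by
    have h2 := continuousOn_pi.2 fun j => continuousOn_chartCoord hφ q j
    exact (PiLp.continuous_toLp 2 fun _ : Fin k => ℝ).comp_continuousOn h2
  exact ((continuousOn_fderivWithin_inChart hf q).clm_apply h1).congr fun y hy =>
    derivAlong_symm hφ hf hy

theorem continuousOn_derivAlong (hφ : IsFreeBoundaryMinimal k φ) {f : M → ℝ}
    (hf : ContMDiff (𝓡∂ k) 𝓘(ℝ, ℝ) ∞ f) (q : M) :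
    ContinuousOn (derivAlong (k := k) φ f) (extChartAt (𝓡∂ k) q).source :=
  ((continuousOn_derivAlong_symm hφ hf q).comp (continuousOn_extChartAt q)
    (extChartAt (𝓡∂ k) q).mapsTo).congr fun p hp => by
      simp only [Function.comp_apply, (extChartAt (𝓡∂ k) q).left_inv hp]

theorem continuousOn_boundaryDensity (hφ : IsFreeBoundaryMinimal k φ) (q : M) :
    ContinuousOn (boundaryDensity φ q)
      (hyperplaneIncl k ⁻¹' (extChartAt (𝓡∂ k) q).target) := by
  intro z hz
  have h1 : Function.Injective ((fderivWithin ℝ (inChart k φ q) (range (𝓡∂ k))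
      (hyperplaneIncl k z)).comp (inclL k)) :=
    (fderivWithin_inChart_injective hφ hz).comp fun a b hab => by
      simpa using congrArg (projL k) hab
  have h2 : ContinuousOn (fun z => (fderivWithin ℝ (inChart k φ q) (range (𝓡∂ k))
      (hyperplaneIncl k z)).comp (inclL k)) (hyperplaneIncl k ⁻¹' (extChartAt (𝓡∂ k) q).target) :=
    ((continuousOn_fderivWithin_inChart hφ.smooth q).comp
      continuous_hyperplaneIncl.continuousOn fun z hz => hz).clm_comp continuousOn_const
  refine ContinuousWithinAt.congr (ContinuousAt.comp_continuousWithinAt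
    (f := fun z => (fderivWithin ℝ (inChart k φ q) (range (𝓡∂ k)) (hyperplaneIncl k z)).comp
      (inclL k)) (differentiableAt_sqrt_det h1).continuousAt (h2 z hz))
    (fun z _ => boundaryDensity_eq φ q z) (boundaryDensity_eq φ q z)

/-- The free boundary condition, in an arbitrary chart. -/
theorem density_mul_chartCoord (hφ : IsFreeBoundaryMinimal k φ)
    {z : EuclideanSpace ℝ {i : Fin k // i ≠ 0}}
    (hz : hyperplaneIncl k z ∈ (extChartAt (𝓡∂ k) q).target) :
    density φ q (hyperplaneIncl k z) * chartCoord φ q (hyperplaneIncl k z) 0 =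
      -boundaryDensity φ q z := by
  set y := hyperplaneIncl k z with hy
  have hy0 : y 0 = 0 := hyperplaneIncl_zero z
  set p := (extChartAt (𝓡∂ k) q).symm y with hp
  have hpb : p ∈ (𝓡∂ k).boundary M := symm_mem_boundary hz hy0
  have hnorm : ‖φ p‖ = 1 := by simpa using hφ.boundary_mem_sphere p hpb
  have hD := hasFDerivWithinAt_inChart hφ.smooth hz
  set D := fderivWithin ℝ (inChart k φ q) (range (𝓡∂ k)) y with hDdef
  have hFy : inChart k φ q y = φ p := rfl
  -- derivatives of `|φ|²` along rays in the half-space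
  have hray : ∀ v : Euc k, 0 ≤ v 0 → HasDerivWithinAt
      (fun t : ℝ => ‖inChart k φ q (y + t • v)‖ ^ 2) (2 * inner ℝ (φ p) (D v)) (Ici 0) 0 := by
    intro v hv
    have hline : HasDerivWithinAt (fun t : ℝ => y + t • v) v (Ici 0) 0 := by
      simpa using (((hasDerivAt_id (0 : ℝ)).smul_const v).const_add y).hasDerivWithinAt
    have hD' : HasFDerivWithinAt (inChart k φ q) D (range (𝓡∂ k)) (y + (0 : ℝ) • v) := by
      rw [zero_smul, add_zero]
      exact hD
    have hmaps : MapsTo (fun t : ℝ => y + t • v) (Ici 0) (range (𝓡∂ k)) := by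
      intro t ht
      rw [range_model]
      have : 0 ≤ t * v 0 := mul_nonneg ht hv
      simpa [hy0] using this
    have h1 := (hD'.comp_hasDerivWithinAt (0 : ℝ) hline hmaps).norm_sq
    simpa [hFy] using h1
  -- The function |φ|² attains its maximum 1 at the boundary point, so its one-sided derivatives
  -- into the manifold are nonpositive.
  have hle : ∀ v : Euc k, 0 ≤ v 0 → inner ℝ (φ p) (D v) ≤ 0 := by
    intro v hv
    have h1 := hasDerivWithinAt_iff_tendsto_slope.1 (hray v hv)
    rw [Ici_sdiff_left] at h1
    have h2 : 2 * inner ℝ (φ p) (D v) ≤ 0 := by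
      refine le_of_tendsto h1 ?_
      filter_upwards [self_mem_nhdsWithin] with t ht
      have h3 : ‖inChart k φ q (y + t • v)‖ ≤ 1 :=
        mem_closedBall_zero_iff.1 (hφ.mem_ball _)
      have h4 : ‖inChart k φ q (y + t • v)‖ ^ 2 ≤ 1 := pow_le_one₀ (norm_nonneg _) h3
      rw [slope_def_field, zero_smul, add_zero, hFy, hnorm]
      exact div_nonpos_of_nonpos_of_nonneg (by linarith) (by simpa using (mem_Ioi.1 ht).le)
    linarith
  -- The conormal is orthogonal to everything orthogonal to φ p, hence a nonzero multiple of it, and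
  -- so φ p is tangent. The sign of the multiple is not needed here, since `hle` already says that φ
  -- p points outward.
  have hr : φ p ∈ range D := by
    obtain ⟨ν, ⟨⟨v, _, hv⟩, _, hν⟩, hperp⟩ := hφ.meets_orthogonally p hpb
    have hpp : inner ℝ (φ p) (φ p) = (1 : ℝ) := by
      rw [real_inner_self_eq_norm_sq, hnorm, one_pow]
    have h1 : inner ℝ (φ p) (ν - (inner ℝ (φ p) ν : ℝ) • φ p) = 0 := by
      rw [inner_sub_right, inner_smul_right, hpp, mul_one, sub_self]
    have h2 : ν - (inner ℝ (φ p) ν : ℝ) • φ p = 0 := by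
      rw [← inner_self_eq_zero (𝕜 := ℝ)]
      nth_rw 1 [inner_sub_left]
      rw [inner_smul_left, h1, hperp _ h1, mul_zero, sub_zero]
    have h3 : inner ℝ (φ p) ν ≠ (0 : ℝ) := by
      intro h
      rw [h, zero_smul, sub_zero] at h2
      rw [h2, norm_zero] at hν
      exact zero_ne_one hν
    obtain ⟨w, hw⟩ := (transDeriv_bijective (mem_overlap_symm hz)).2
      ((inner ℝ (φ p) ν : ℝ)⁻¹ • v)
    refine ⟨w, ?_⟩
    rw [hDdef, differential_comp_transDeriv hφ hz, ContinuousLinearMap.comp_apply, hw, map_smul,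
      hv, sub_eq_zero.1 h2, inner_smul_right, hpp, mul_one, smul_smul, inv_mul_cancel₀ h3,
      one_smul]
  -- Along the hyperplane both directions ±eᵢ are admissible in `hle`.
  have hzero : ∀ i, i ≠ 0 → inner ℝ (φ p) (D (EuclideanSpace.single i 1)) = 0 := by
    intro i hi
    refine le_antisymm (hle _ (by simp [hi.symm])) ?_
    have := hle (-EuclideanSpace.single i 1) (by simp [hi.symm])
    rw [map_neg, inner_neg_right] at this
    linarith
  exact sqrt_det_mul_tangentCoord_zero (fderivWithin_inChart_injective hφ hz) hnorm hr hzero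
    (hle _ (by simp))

end ChartIntegrals

/-! ### The divergence theorem for functions supported in one chart -/

section ChartIdentity

open Topology

theorem integrableOn_of_eq_zero_off_compact {X : Type*} [TopologicalSpace X] [T2Space X]
    [MeasureSpace X] [BorelSpace X] [IsFiniteMeasureOnCompacts (volume : Measure X)]
    {w : X → ℝ} {T K : Set X} (hw : ContinuousOn w T)
    (hT : MeasurableSet T) (hK : IsCompact K) (hKT : K ⊆ T) (h0 : ∀ y ∈ T, y ∉ K → w y = 0) :
    IntegrableOn w T :=
  ((hw.mono hKT).integrableOn_compact hK).of_forall_sdiff_eq_zero hT fun y hy => h0 y hy.1 hy.2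

variable {k n : ℕ} [NeZero k] {M : Type*} [TopologicalSpace M] [CompactSpace M]
  [ChartedSpace (EuclideanHalfSpace k) M] [IsManifold (𝓡∂ k) ∞ M] {φ : M → Euc n}

/-- The divergence theorem for the field `f x^⊤`, where `f` is supported in the domain of a
chart. -/
theorem integral_chart (hφ : IsFreeBoundaryMinimal k φ) {f : M → ℝ}
    (hf : ContMDiff (𝓡∂ k) 𝓘(ℝ, ℝ) ∞ f) {q : M}
    (hsupp : tsupport f ⊆ (extChartAt (𝓡∂ k) q).source) :
    IntegrableOn (fun y => density φ q y * f ((extChartAt (𝓡∂ k) q).symm y))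
      (extChartAt (𝓡∂ k) q).target ∧
    IntegrableOn (fun y => density φ q y *
      derivAlong (k := k) φ f ((extChartAt (𝓡∂ k) q).symm y)) (extChartAt (𝓡∂ k) q).target ∧
    IntegrableOn (fun z => boundaryDensity φ q z *
        f ((extChartAt (𝓡∂ k) q).symm (hyperplaneIncl k z)))
      (hyperplaneIncl k ⁻¹' (extChartAt (𝓡∂ k) q).target) ∧
    k * (∫ y in (extChartAt (𝓡∂ k) q).target,
        density φ q y * f ((extChartAt (𝓡∂ k) q).symm y)) +
      ∫ y in (extChartAt (𝓡∂ k) q).target,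
        density φ q y * derivAlong (k := k) φ f ((extChartAt (𝓡∂ k) q).symm y) =
      ∫ z in hyperplaneIncl k ⁻¹' (extChartAt (𝓡∂ k) q).target,
        boundaryDensity φ q z * f ((extChartAt (𝓡∂ k) q).symm (hyperplaneIncl k z)) := by
  set T := (extChartAt (𝓡∂ k) q).target with hTdef
  set a := (extChartAt (𝓡∂ k) q).symm with ha
  set K := extChartAt (𝓡∂ k) q '' tsupport f with hKdef
  have hTm : MeasurableSet T := measurableSet_target q
  have hK : IsCompact K := (isClosed_tsupport f).isCompact.image_of_continuousOn
    ((continuousOn_extChartAt q).mono hsupp)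
  have hKT : K ⊆ T := by
    rintro _ ⟨p, hp, rfl⟩
    exact (extChartAt (𝓡∂ k) q).map_source (hsupp hp)
  have hoff : ∀ y ∈ T, y ∉ K → a y ∉ tsupport f := fun y hy hyK h =>
    hyK ⟨a y, h, (extChartAt (𝓡∂ k) q).right_inv hy⟩
  have hf0 : ∀ y ∈ T, y ∉ K → f (a y) = 0 := fun y hy hyK =>
    image_eq_zero_of_notMem_tsupport (hoff y hy hyK)
  have hd0 : ∀ y ∈ T, y ∉ K → derivAlong (k := k) φ f (a y) = 0 := fun y hy hyK =>
    derivAlong_eq_zero φ (hoff y hy hyK)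
  have hfc : ContinuousOn (fun y => f (a y)) T := (contDiffOn_inChart hf q).continuousOn
  have hdc := continuousOn_derivAlong_symm hφ hf q
  have hρ := continuousOn_density hφ q
  have hi1 : IntegrableOn (fun y => density φ q y * f (a y)) T :=
    integrableOn_of_eq_zero_off_compact (hρ.mul hfc) hTm hK hKT fun y hy hyK => by
      rw [hf0 y hy hyK, mul_zero]
  have hi2 : IntegrableOn (fun y => density φ q y * derivAlong (k := k) φ f (a y)) T :=
    integrableOn_of_eq_zero_off_compact (hρ.mul hdc) hTm hK hKT fun y hy hyK => by
      rw [hd0 y hy hyK, mul_zero]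
  have hBm : MeasurableSet (hyperplaneIncl k ⁻¹' T) :=
    continuous_hyperplaneIncl.measurable hTm
  have hBK : IsCompact (hyperplaneIncl k ⁻¹' K) := by
    refine (hK.image (projL k).continuous).of_isClosed_subset
      (hK.isClosed.preimage continuous_hyperplaneIncl) fun z hz => ⟨_, hz, projL_hyperplaneIncl z⟩
  have hi3 : IntegrableOn (fun z => boundaryDensity φ q z * f (a (hyperplaneIncl k z)))
      (hyperplaneIncl k ⁻¹' T) :=
    integrableOn_of_eq_zero_off_compact ((continuousOn_boundaryDensity hφ q).mul
      (hfc.comp continuous_hyperplaneIncl.continuousOn fun z hz => hz)) hBm hBK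
      (preimage_mono hKT) fun z hz hzK => by rw [hf0 _ hz hzK, mul_zero]
  refine ⟨hi1, hi2, hi3, ?_⟩
  have hrange : {x : Euc k | 0 ≤ x 0} = range (𝓡∂ k) := (range_model k).symm
  have hTH : T ⊆ {x : Euc k | 0 ≤ x 0} := hrange ▸ extChartAt_target_subset_range q
  -- The field √(det g) f c, extended by zero off the chart. Its support lies in the compact set
  -- `K`, so the extension creates no new singularities.
  let V : Fin k → Euc k → ℝ := fun j =>
    T.indicator fun y => density φ q y * (f (a y) * chartCoord φ q y j)
  let h : Euc k → ℝ := T.indicator fun y =>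
    k * (density φ q y * f (a y)) + density φ q y * derivAlong (k := k) φ f (a y)
  have hVK : ∀ x, x ∉ K → ∀ j, V j x = 0 := by
    intro x hx j
    by_cases hxT : x ∈ T
    · simp only [V, indicator_of_mem hxT, hf0 x hxT hx, zero_mul, mul_zero]
    · exact indicator_of_notMem hxT _
  have hhK : ∀ x, x ∉ K → h x = 0 := by
    intro x hx
    by_cases hxT : x ∈ T
    · simp only [h, indicator_of_mem hxT, hf0 x hxT hx, hd0 x hxT hx, mul_zero, add_zero]
    · exact indicator_of_notMem hxT _
  have hhi : Integrable h := by
    rw [integrable_indicator_iff hTm]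
    exact (hi1.const_mul _).add hi2
  have hVc : ∀ j, ContinuousOn (V j) {x | 0 ≤ x 0} := by
    intro j x hx
    -- At points of `K` the target is a relative neighbourhood in the half-space; off the closed set
    -- `K` the field vanishes nearby.
    by_cases hxK : x ∈ K
    · have hxT := hKT hxK
      have h1 : ContinuousWithinAt (fun y => density φ q y * (f (a y) * chartCoord φ q y j)) T x :=
        (hρ.mul (hfc.mul (continuousOn_chartCoord hφ q j))) x hxT
      have h2 : ContinuousWithinAt (V j) T x :=
        h1.congr (fun y hy => indicator_of_mem hy _) (indicator_of_mem hxT _)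
      rw [hrange]
      exact h2.mono_of_mem_nhdsWithin (extChartAt_target_mem_nhdsWithin_of_mem hxT)
    · have h1 : V j =ᶠ[𝓝 x] fun _ => 0 := by
        filter_upwards [hK.isClosed.isOpen_compl.mem_nhds hxK] with y hy
        exact hVK y hy j
      exact (continuousAt_const.congr h1.symm).continuousWithinAt
  have hmain := integral_divergence_halfSpace V h hK.isBounded hVc (fun x _ hx => hVK x hx)
    (fun x _ hx => hhK x hx) (fun x hx0 => by
      by_cases hxK : x ∈ K
      · have hxT := hKT hxK
        have hnear : ∀ᶠ z in 𝓝 x, z ∈ T := target_mem_nhds hxT hx0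
        have heq := fderivWithin_range_eventuallyEq (inChart k φ q) hx0
        have hinj : ∀ᶠ z in 𝓝 x, Function.Injective (fderiv ℝ (inChart k φ q) z) := by
          filter_upwards [hnear, heq] with z hz1 hz2
          rw [← hz2]
          exact fderivWithin_inChart_injective hφ hz1
        have hud : HasFDerivAt (fun y => f (a y)) (fderivWithin ℝ (f ∘ a) (range (𝓡∂ k)) x) x :=
          (hasFDerivWithinAt_inChart hf hxT).hasFDerivAt (range_mem_nhds hx0)
        obtain ⟨V', h1, h2⟩ := divergence_tangentCoord (F := inChart k φ q)
          ((contDiffAt_inChart hφ.smooth hxT hx0).of_le (by norm_cast)) hinj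
          (fun N hN => minimal_inChart hφ hxT hx0 hN) hud
        refine ⟨V', fun j => (h1 j).congr_of_eventuallyEq ?_, ?_⟩
        · filter_upwards [hnear, heq] with z hz1 hz2
          simp only [V, indicator_of_mem hz1, density, chartCoord, coordMetric_eq, hz2]
        · have h3 : h x = k * (density φ q x * f (a x)) + density φ q x *
              fderivWithin ℝ (f ∘ a) (range (𝓡∂ k)) x (chartCoord φ q x) := by
            rw [← derivAlong_symm hφ hf hxT]
            exact indicator_of_mem hxT _
          rw [h2, h3, density, chartCoord, coordMetric_eq, heq.self_of_nhds, Fintype.card_fin]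
          ring
      · have h1 : ∀ j, V j =ᶠ[𝓝 x] fun _ => 0 := by
          intro j
          filter_upwards [hK.isClosed.isOpen_compl.mem_nhds hxK] with y hy
          exact hVK y hy j
        exact ⟨0, fun j => (hasFDerivAt_const (0 : ℝ) x).congr_of_eventuallyEq (h1 j), by
          simp [hhK x hxK]⟩) hhi.integrableOn
  have hL : ∫ x in {x : Euc k | 0 ≤ x 0}, h x = ∫ y in T,
      (k * (density φ q y * f (a y)) + density φ q y * derivAlong (k := k) φ f (a y)) := by
    rw [setIntegral_indicator hTm, inter_eq_self_of_subset_right hTH]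
  -- The free boundary condition identifies the flux density with the boundary density.
  have hR : -∫ z, V 0 (hyperplaneIncl k z) = ∫ z in hyperplaneIncl k ⁻¹' T,
      boundaryDensity φ q z * f (a (hyperplaneIncl k z)) := by
    rw [← integral_indicator hBm, ← integral_neg]
    refine integral_congr_ae (Filter.Eventually.of_forall fun z => ?_)
    by_cases hz : hyperplaneIncl k z ∈ T
    · have hz' : z ∈ hyperplaneIncl k ⁻¹' T := hz
      have := density_mul_chartCoord hφ hz
      simp only [V, indicator_of_mem hz, indicator_of_mem hz']
      linear_combination (-f (a (hyperplaneIncl k z))) * this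
    · have hz' : z ∉ hyperplaneIncl k ⁻¹' T := hz
      simp only [V, indicator_of_notMem hz, indicator_of_notMem hz', neg_zero]
  rw [← hR, ← hmain, hL, integral_add (hi1.const_mul _) hi2, integral_const_mul]

end ChartIdentity

/-! ### Compatibility of the chart measures and the global identity -/

section Global

open Topology

variable {k n : ℕ} [NeZero k] {M : Type*} [TopologicalSpace M]
  [ChartedSpace (EuclideanHalfSpace k) M]

theorem mem_overlap_of_subset {A : Set M} {q p : M}
    (hA : A ⊆ (extChartAt (𝓡∂ k) q).source ∩ (extChartAt (𝓡∂ k) p).source)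
    {y : Euc k} (hy : y ∈ (extChartAt (𝓡∂ k) q).target)
    (hyA : (extChartAt (𝓡∂ k) q).symm y ∈ A) : y ∈ overlap q p :=
  ⟨hy, (hA hyA).2⟩

theorem measurableSet_boundary_target (q : M) :
    MeasurableSet (hyperplaneIncl k ⁻¹' (extChartAt (𝓡∂ k) q).target) :=
  continuous_hyperplaneIncl.measurable (measurableSet_target q)

theorem continuousOn_boundary_symm (q : M) :
    ContinuousOn (fun z => (extChartAt (𝓡∂ k) q).symm (hyperplaneIncl k z))
      (hyperplaneIncl k ⁻¹' (extChartAt (𝓡∂ k) q).target) :=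
  (continuousOn_extChartAt_symm q).comp continuous_hyperplaneIncl.continuousOn fun _ hz => hz

variable [IsManifold (𝓡∂ k) ∞ M] {φ : M → Euc n}

theorem density_transition (hφ : IsFreeBoundaryMinimal k φ) {q p : M} {y : Euc k}
    (hy : y ∈ overlap q p) :
    density φ q y = |(transDeriv q p y).det| * density φ p (transition q p y) := by
  rw [density, density, coordMetric_eq, coordMetric_eq, inChart_def, inChart_def,
    fderivWithin_transition hφ.smooth hy, sqrt_det_metricOf_comp]

/-- The coordinate change of the boundary. -/
def boundaryTransition (q p : M) (z : EuclideanSpace ℝ {i : Fin k // i ≠ 0}) :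
    EuclideanSpace ℝ {i : Fin k // i ≠ 0} :=
  projL k (transition q p (hyperplaneIncl k z))

/-- The derivative of the coordinate change of the boundary. -/
def boundaryTransDeriv (q p : M) (z : EuclideanSpace ℝ {i : Fin k // i ≠ 0}) :
    EuclideanSpace ℝ {i : Fin k // i ≠ 0} →L[ℝ] EuclideanSpace ℝ {i : Fin k // i ≠ 0} :=
  (projL k).comp ((transDeriv q p (hyperplaneIncl k z)).comp (inclL k))

theorem hyperplaneIncl_boundaryTransition {q p : M} {z : EuclideanSpace ℝ {i : Fin k // i ≠ 0}}
    (hz : hyperplaneIncl k z ∈ overlap q p) :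
    hyperplaneIncl k (boundaryTransition q p z) = transition q p (hyperplaneIncl k z) :=
  hyperplaneIncl_projL (transition_zero_eq hz (hyperplaneIncl_zero z))

theorem boundaryTransition_boundaryTransition {q p : M}
    {z : EuclideanSpace ℝ {i : Fin k // i ≠ 0}} (hz : hyperplaneIncl k z ∈ overlap q p) :
    boundaryTransition p q (boundaryTransition q p z) = z := by
  rw [boundaryTransition, hyperplaneIncl_boundaryTransition hz, transition_transition hz,
    projL_hyperplaneIncl]

theorem boundaryDensity_transition (hφ : IsFreeBoundaryMinimal k φ) {q p : M}
    {z : EuclideanSpace ℝ {i : Fin k // i ≠ 0}} (hz : hyperplaneIncl k z ∈ overlap q p) :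
    boundaryDensity φ q z =
      |(boundaryTransDeriv q p z).det| * boundaryDensity φ p (boundaryTransition q p z) := by
  rw [boundaryDensity_eq, boundaryDensity_eq, hyperplaneIncl_boundaryTransition hz, inChart_def,
    inChart_def, fderivWithin_transition hφ.smooth hz, ← sqrt_det_metricOf_comp]
  congr 3
  ext1 v
  -- The coordinate change maps vectors tangent to the hyperplane to such vectors, so projecting and
  -- including again changes nothing.
  have h1 : hyperplaneIncl k (projL k (transDeriv q p (hyperplaneIncl k z) (hyperplaneIncl k v))) =
      transDeriv q p (hyperplaneIncl k z) (hyperplaneIncl k v) :=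
    hyperplaneIncl_projL (transDeriv_zero_eq hz (hyperplaneIncl_zero z) (hyperplaneIncl_zero v))
  simp only [boundaryTransDeriv, ContinuousLinearMap.comp_apply, inclL_apply, h1]

variable [MeasurableSpace M] [BorelSpace M]

theorem chartVolume_eq_of_subset (hφ : IsFreeBoundaryMinimal k φ) (q p : M) {A : Set M}
    (hAm : MeasurableSet A)
    (hA : A ⊆ (extChartAt (𝓡∂ k) q).source ∩ (extChartAt (𝓡∂ k) p).source) :
    chartVolume k φ q A = chartVolume k φ p A := by
  refine paramMeasure_eq_of_transition (w := density φ q) (v := density φ p)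
    (measurableSet_target q) (continuousOn_extChartAt_symm q)
    (measurableSet_target p) (continuousOn_extChartAt_symm p) hAm
    (τ := transition q p) (τ' := transDeriv q p) ?_ ?_ ?_ ?_
  · intro y hy
    exact (hasFDerivWithinAt_transition (mem_overlap_of_subset hA hy.1 hy.2)).mono fun z hz =>
      mem_range_of_mem_target hz.1
  · intro y hy z hz h
    rw [← transition_transition (mem_overlap_of_subset hA hy.1 hy.2), h,
      transition_transition (mem_overlap_of_subset hA hz.1 hz.2)]
  · ext z
    constructor
    · rintro ⟨y, hy, rfl⟩
      have hov := mem_overlap_of_subset hA hy.1 hy.2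
      refine ⟨(transition_mem_overlap hov).1, ?_⟩
      rw [mem_preimage, symm_transition hov]
      exact hy.2
    · rintro ⟨hz, hzA⟩
      have hov := mem_overlap_of_subset (hA.trans (inter_comm _ _).subset) hz hzA
      refine ⟨transition p q z, ⟨(transition_mem_overlap hov).1, ?_⟩, transition_transition hov⟩
      rw [mem_preimage, symm_transition hov]
      exact hzA
  · exact fun y hy => density_transition hφ (mem_overlap_of_subset hA hy.1 hy.2)

theorem chartBoundaryVolume_eq_of_subset (hφ : IsFreeBoundaryMinimal k φ) (q p : M) {A : Set M}
    (hAm : MeasurableSet A)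
    (hA : A ⊆ (extChartAt (𝓡∂ k) q).source ∩ (extChartAt (𝓡∂ k) p).source) :
    chartBoundaryVolume k φ q A = chartBoundaryVolume k φ p A := by
  refine paramMeasure_eq_of_transition (w := boundaryDensity φ q) (v := boundaryDensity φ p)
    (measurableSet_boundary_target q) (continuousOn_boundary_symm q)
    (measurableSet_boundary_target p) (continuousOn_boundary_symm p) hAm
    (τ := boundaryTransition q p) (τ' := boundaryTransDeriv q p) ?_ ?_ ?_ ?_
  · intro z hz
    have h1 := hasFDerivWithinAt_transition (mem_overlap_of_subset hA hz.1 hz.2)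
    refine (projL k).hasFDerivAt.comp_hasFDerivWithinAt z ?_
    exact HasFDerivWithinAt.comp z h1 (inclL k).hasFDerivWithinAt fun x hx =>
      mem_range_of_mem_target hx.1
  · intro y hy z hz h
    rw [← boundaryTransition_boundaryTransition (mem_overlap_of_subset hA hy.1 hy.2), h,
      boundaryTransition_boundaryTransition (mem_overlap_of_subset hA hz.1 hz.2)]
  · ext z
    constructor
    · rintro ⟨y, hy, rfl⟩
      have hov := mem_overlap_of_subset hA hy.1 hy.2
      constructor
      · rw [mem_preimage, hyperplaneIncl_boundaryTransition hov]
        exact (transition_mem_overlap hov).1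
      · rw [mem_preimage, hyperplaneIncl_boundaryTransition hov, symm_transition hov]
        exact hy.2
    · rintro ⟨hz, hzA⟩
      have hov := mem_overlap_of_subset (hA.trans (inter_comm _ _).subset) hz hzA
      refine ⟨boundaryTransition p q z, ⟨?_, ?_⟩, boundaryTransition_boundaryTransition hov⟩
      · rw [mem_preimage, hyperplaneIncl_boundaryTransition hov]
        exact (transition_mem_overlap hov).1
      · rw [mem_preimage, hyperplaneIncl_boundaryTransition hov, symm_transition hov]
        exact hzA
  · exact fun y hy => boundaryDensity_transition hφ (mem_overlap_of_subset hA hy.1 hy.2)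

variable [CompactSpace M]

omit [IsManifold (𝓡∂ k) ∞ M] [MeasurableSpace M] [BorelSpace M] [CompactSpace M] in
theorem iUnion_source : ⋃ q : M, (extChartAt (𝓡∂ k) q).source = univ :=
  eq_univ_of_forall fun p => mem_iUnion.2 ⟨p, mem_extChartAt_source p⟩

theorem inducedVolume_restrict (hφ : IsFreeBoundaryMinimal k φ) (q : M) :
    (inducedVolume k φ).restrict (extChartAt (𝓡∂ k) q).source = chartVolume k φ q :=
  iSup_restrict_eq (chartVolume k φ) (fun q => (extChartAt (𝓡∂ k) q).source)
    (fun q => isOpen_extChartAt_source q) iUnion_source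
    (fun q _ hA => paramMeasure_inter_eq (measurableSet_target q) (continuousOn_extChartAt_symm q)
      (isOpen_extChartAt_source q).measurableSet (extChartAt (𝓡∂ k) q).symm.mapsTo hA)
    (fun q p _ hAm hA => chartVolume_eq_of_subset hφ q p hAm hA) q

theorem inducedBoundaryVolume_restrict (hφ : IsFreeBoundaryMinimal k φ) (q : M) :
    (inducedBoundaryVolume k φ).restrict (extChartAt (𝓡∂ k) q).source =
      chartBoundaryVolume k φ q :=
  iSup_restrict_eq (chartBoundaryVolume k φ) (fun q => (extChartAt (𝓡∂ k) q).source)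
    (fun q => isOpen_extChartAt_source q) iUnion_source
    (fun q _ hA => paramMeasure_inter_eq (measurableSet_boundary_target q)
      (continuousOn_boundary_symm q) (isOpen_extChartAt_source q).measurableSet
      (fun _ hz => symm_mem_source hz) hA)
    (fun q p _ hAm hA => chartBoundaryVolume_eq_of_subset hφ q p hAm hA) q

/-- The divergence theorem for the field `f x^⊤`, where `f` is supported in the domain of a
chart, in terms of the induced measures. -/
theorem integral_add_integral_derivAlong (hφ : IsFreeBoundaryMinimal k φ) {f : M → ℝ}
    (hf : ContMDiff (𝓡∂ k) 𝓘(ℝ, ℝ) ∞ f) {q : M}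
    (hsupp : tsupport f ⊆ (extChartAt (𝓡∂ k) q).source) :
    Integrable f (inducedVolume k φ) ∧
    Integrable (derivAlong (k := k) φ f) (inducedVolume k φ) ∧
    Integrable f (inducedBoundaryVolume k φ) ∧
    k * (∫ p, f p ∂(inducedVolume k φ)) + ∫ p, derivAlong (k := k) φ f p ∂(inducedVolume k φ) =
      ∫ p, f p ∂(inducedBoundaryVolume k φ) := by
  obtain ⟨h1, h2, h3, h4⟩ := integral_chart hφ hf hsupp
  have hU : MeasurableSet (extChartAt (𝓡∂ k) q).source :=
    (isOpen_extChartAt_source q).measurableSet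
  have hf0 : ∀ p, p ∉ (extChartAt (𝓡∂ k) q).source → f p = 0 := fun p hp =>
    image_eq_zero_of_notMem_tsupport fun h => hp (hsupp h)
  obtain ⟨i1, e1⟩ := integrable_and_integral_eq hU (inducedVolume_restrict hφ q)
    (w := density φ q) (measurableSet_target q) (continuousOn_extChartAt_symm q)
    (continuousOn_density hφ q) (fun _ _ => Real.sqrt_nonneg _) hf.continuous.continuousOn hf0 h1
  obtain ⟨i2, e2⟩ := integrable_and_integral_eq hU (inducedVolume_restrict hφ q)
    (w := density φ q) (measurableSet_target q) (continuousOn_extChartAt_symm q)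
    (continuousOn_density hφ q) (fun _ _ => Real.sqrt_nonneg _) (continuousOn_derivAlong hφ hf q)
    (fun p hp => derivAlong_eq_zero φ fun h => hp (hsupp h)) h2
  obtain ⟨i3, e3⟩ := integrable_and_integral_eq hU (inducedBoundaryVolume_restrict hφ q)
    (w := boundaryDensity φ q) (measurableSet_boundary_target q) (continuousOn_boundary_symm q)
    (continuousOn_boundaryDensity hφ q) (fun _ _ => Real.sqrt_nonneg _)
    hf.continuous.continuousOn hf0 h3
  exact ⟨i1, i2, i3, by rw [e1, e2, e3, h4]⟩

-- The differentials of functions with constant sum add up to zero, so the gradient terms of the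
-- localised identities cancel.
omit [MeasurableSpace M] [BorelSpace M] [CompactSpace M] in
theorem sum_derivAlong_eq_zero (φ : M → Euc n) {ι : Type*} (t : Finset ι) {f : ι → M → ℝ}
    (hf : ∀ i, ContMDiff (𝓡∂ k) 𝓘(ℝ, ℝ) ∞ (f i)) (hsum : ∀ p, ∑ i ∈ t, f i p = 1) (p : M) :
    ∑ i ∈ t, derivAlong (k := k) φ (f i) p = 0 := by
  have h1 : ∑ i ∈ t, fderivWithin ℝ (f i ∘ (extChartAt (𝓡∂ k) p).symm) (range (𝓡∂ k))
      (extChartAt (𝓡∂ k) p p) = 0 := by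
    rw [← fderivWithin_fun_sum
      (uniqueDiffOn_range_model k _ (mem_range_of_mem_target (mem_extChartAt_target p)))
      fun i _ => (hasFDerivWithinAt_inChart (hf i)
        (mem_extChartAt_target p)).differentiableWithinAt]
    simp only [Function.comp_apply, hsum]
    exact fderivWithin_const_apply _
  have h2 := DFunLike.congr_fun h1 (tangentField (k := k) φ p)
  rw [sum_apply] at h2
  refine Eq.trans (Finset.sum_congr rfl fun i _ => ?_) h2
  rw [derivAlong, mfderiv_eq (hf i)]
  rfl

theorem mul_inducedVolume_univ [T2Space M] (hφ : IsFreeBoundaryMinimal k φ) :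
    inducedVolume k φ univ ≠ ⊤ ∧
      (k : ℝ≥0∞) * inducedVolume k φ univ = inducedBoundaryVolume k φ univ := by
  obtain ⟨ρ, hρ⟩ := SmoothPartitionOfUnity.exists_isSubordinate_chartAt_source (𝓡∂ k) M
  have hfin : {i | (Function.support (ρ i)).Nonempty}.Finite :=
    ρ.locallyFinite.finite_nonempty_of_compact
  set t := hfin.toFinset
  have hsum : ∀ p, ∑ i ∈ t, ρ i p = 1 := by
    intro p
    rw [← ρ.sum_eq_one (mem_univ p)]
    refine (finsum_eq_sum_of_support_subset _ fun i hi => ?_).symm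
    exact hfin.mem_toFinset.2 ⟨p, hi⟩
  have hsm : ∀ i, ContMDiff (𝓡∂ k) 𝓘(ℝ, ℝ) ∞ (ρ i) := fun i => (ρ i).contMDiff
  have hchart : ∀ i : M, tsupport (ρ i) ⊆ (extChartAt (𝓡∂ k) i).source := fun i => by
    rw [extChartAt_source]
    exact hρ i
  have key := fun i => integral_add_integral_derivAlong hφ (hsm i) (hchart i)
  -- The constant 1 is a finite sum of integrable functions, which forces the measure to be finite.
  have hone : ∀ μ : Measure M, (∀ i, Integrable (ρ i) μ) →
      μ univ ≠ ⊤ ∧ ∑ i ∈ t, ∫ p, ρ i p ∂μ = μ.real univ := by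
    intro μ hμ
    have h1 : Integrable (fun _ : M => (1 : ℝ)) μ := by
      refine (integrable_finsetSum t fun i _ => hμ i).congr (Filter.Eventually.of_forall fun p => ?_)
      exact hsum p
    have h2 : IsFiniteMeasure μ := (integrable_const_iff_isFiniteMeasure one_ne_zero).1 h1
    refine ⟨measure_ne_top μ univ, ?_⟩
    rw [← integral_finsetSum t fun i _ => hμ i]
    simp only [hsum, integral_const, smul_eq_mul, mul_one]
  obtain ⟨hv, hv'⟩ := hone (inducedVolume k φ) fun i => (key i).1
  obtain ⟨hb, hb'⟩ := hone (inducedBoundaryVolume k φ) fun i => (key i).2.2.1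
  refine ⟨hv, ?_⟩
  have hd : ∑ i ∈ t, ∫ p, derivAlong (k := k) φ (ρ i) p ∂(inducedVolume k φ) = 0 := by
    rw [← integral_finsetSum t fun i _ => (key i).2.1]
    simp only [sum_derivAlong_eq_zero φ t hsm hsum, integral_zero]
  have hreal : (k : ℝ) * (inducedVolume k φ).real univ = (inducedBoundaryVolume k φ).real univ := by
    rw [← hv', ← hb', Finset.mul_sum, ← add_zero (∑ i ∈ t, _), ← hd, ← Finset.sum_add_distrib]
    exact Finset.sum_congr rfl fun i _ => (key i).2.2.2
  -- Both sides are finite, so the identity of real numbers suffices.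
  rw [← ENNReal.toReal_eq_toReal_iff' (ENNReal.mul_ne_top (ENNReal.natCast_ne_top k) hv) hb,
    ENNReal.toReal_mul, ENNReal.toReal_natCast]
  exact hreal

end Global

end FreeBoundary

end

theorem mainTheorem2 {n k : ℕ} [NeZero k] {M : Type*} [TopologicalSpace M] [T2Space M]
    [CompactSpace M] [ChartedSpace (EuclideanHalfSpace k) M] [IsManifold (𝓡∂ k) ∞ M]
    [MeasurableSpace M] [BorelSpace M] (φ : M → EuclideanSpace ℝ (Fin n))
    (hφ : FreeBoundary.IsFreeBoundaryMinimal k φ) :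
    FreeBoundary.inducedVolume k φ univ ≠ ⊤ ∧
      (k : ℝ≥0∞) * FreeBoundary.inducedVolume k φ univ =
        FreeBoundary.inducedBoundaryVolume k φ univ :=
  FreeBoundary.mul_inducedVolume_univ hφ
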